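/- **Theorem (The Covering Fraenkel Conjecture is true for $m\le 5$).** For integers $q,p>0$ and $r$ let $\mathcal B_{p,r}^q=\{\lfloor nq/p+r\rfloor : n\in\mathbb Z\}$. Call sets $S_1,\dots,S_m\subseteq\mathbb Z$ a *perfect covering* of $\mathbb Z$ if there is an integer $c$ such that every $x\in\mathbb Z$ lies in exactly $c$ of the sets $S_1,\dots,S_m$ (counted with index). Let $q\ge 3$ and $3\le m\le 5$, and let $p_1,\dots,p_m$ be distinct integers with $0<p_k<q$ and $\gcd(q,p_1,\dots,p_m)=1$, such that no nonempty proper subset $I\subsetneq\{1,\dots,m\}$ satisfies $\sum_{i\in I}p_i\equiv 0\pmod q$. Let $r_1,\dots,r_m$ be arbitrary integers. Then the sets $\mathcal B_{p_k,r_k}^q$ ($1\le k\le m$) are a perfect covering of $\mathbb Z$ if and only if both of the following hold: (i) $q$ is odd, and $m$ is the multiplicative order of $2$ modulo $q$; (ii) the sets can be renumbered so that there are integers $\delta$ (relatively prime to $q$, with inverse $\bar\delta$ modulo $q$) and $\gamma$ such that for $1\le k\le m$ $$p_k\equiv \delta\,2^{m-k}\pmod q\quad\text{and}\quad r_k\equiv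 \gamma-\bar\delta\,2^{k-1}\pmod q.$$ -/

import Mathlib

/-- The rational Beatty set `{⌊n * (q / p) + r⌋ : n ∈ ℤ}`. -/
def beattySet (q p r : ℤ) : Set ℤ :=
  Set.range fun n : ℤ => ⌊(n : ℚ) * ((q : ℚ) / (p : ℚ)) + (r : ℚ)⌋

/-- The sets `S k` are a perfect `c`-fold covering of `ℤ`: their indicator functions
sum to the constant `c`. -/
def IsPerfectCFoldCovering {m : ℕ} (S : Fin m → Set ℤ) (c : ℕ) : Prop :=
  ∀ x : ℤ, ∑ k : Fin m, (S k).indicator (fun _ => (1 : ℕ)) x = c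

/-- The sets `S k` are a perfect covering of `ℤ` (of some multiplicity). -/
def IsPerfectCovering {m : ℕ} (S : Fin m → Set ℤ) : Prop :=
  ∃ c : ℕ, IsPerfectCFoldCovering S c

/-- After renumbering by some `σ`, there are integers `δ` (coprime to `q`, with inverse `δ'`
modulo `q`) and `γ` such that `p_k ≡ δ 2^(m-k)` and `r_k ≡ γ - δ' 2^(k-1)` modulo `q` for
`1 ≤ k ≤ m`. The elements of `Fin m` are counted from `0`, so the `k` below stands for `k - 1`. -/
def IsBinaryFamily (q : ℕ) {m : ℕ} (p r : Fin m → ℤ) : Prop :=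
  ∃ (σ : Equiv.Perm (Fin m)) (δ δ' γ : ℤ),
    IsCoprime δ (q : ℤ) ∧ δ * δ' ≡ 1 [ZMOD (q : ℤ)] ∧
    ∀ k : Fin m,
      p (σ k) ≡ δ * 2 ^ (m - 1 - (k : ℕ)) [ZMOD (q : ℤ)] ∧
      r (σ k) ≡ γ - δ' * 2 ^ (k : ℕ) [ZMOD (q : ℤ)]

/-! Multiplied by `q`, the indicator of a Beatty set is `p` plus the forward difference of the
sawtooth `x ↦ (-p (x - r)) mod q`. Hence the covering is perfect iff the sum `F` of the sawtooths is
constant on `ZMod q` (`isPerfectCovering_iff`). For a binary family each summand is a difference at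
consecutive powers of two plus a constant, and `F` telescopes (`two_mul_sum_val_sub_half`).

Conversely, a constant `F` has no nonzero Fourier frequencies. The coefficient of one sawtooth at
`j` vanishes unless `gcd(p, q)` divides `j`; otherwise it is a multiple of `e(j (r + b)) / (e(j b) -
1)`, where `p b = gcd(p, q)`. At `j = p_k` with minimal gcd this gives a vanishing sum over the
indices of the same gcd (`sum_fourier_class`). Since `p_i ≠ ± p_k` modulo `q`, such a class has at
least three members, so for `m ≤ 5` there is only one, and it consists of the invertible `p_i`.

In that class the `i`-th term has modulus proportional to `csc(π a / q)`, where `a = ± p_k / p_i`.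
The term `i = k` is the largest and cannot exceed the sum of the others. The values `a` are distinct
and the cosecants decay roughly like `1 / a`, so `a = 2` must occur for every `k`, apart from `q =
11, 13` with five members. Halving up to sign then permutes the class of size `n`, whence `2 ^ n = ±
1` and `q = 2 ^ n ± 1`. The cosecants at powers of two telescope: for `2 ^ n + 1` the triangle
inequality fails, and for `2 ^ n - 1` it is an equality, which fixes signs and phases and hence the
shifts. The class is closed under halving, so it has sum zero and is everything. The moduli 11 and
13 fall to a finite search. -/

/-! ### Perfect coverings and constant sums of sawtooth functions -/

/-- An integer lies in a rational Beatty set iff a residue modulo `q` is small. -/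
theorem mem_beattySet_iff {q p : ℤ} (r x : ℤ) (hp : 0 < p) (hq : 0 < q) :
    x ∈ beattySet q p r ↔ (-(p * (x - r))) % q < p := by
  have hpQ : (0 : ℚ) < p := by exact_mod_cast hp
  have key : ∀ n : ℤ, ⌊(n : ℚ) * ((q : ℚ) / (p : ℚ)) + (r : ℚ)⌋ = x ↔
      p * (x - r) ≤ n * q ∧ n * q < p * (x - r) + p := by
    intro n
    have e : (n : ℚ) * ((q : ℚ) / (p : ℚ)) = (n * q) / p := by ring
    rw [Int.floor_eq_iff, e, ← sub_le_iff_le_add, ← lt_sub_iff_add_lt, le_div_iff₀ hpQ,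
      div_lt_iff₀ hpQ]
    constructor
    · rintro ⟨h1, h2⟩
      have h1' : (((x - r) * p : ℤ) : ℚ) ≤ ((n * q : ℤ) : ℚ) := by push_cast; exact h1
      have h2' : ((n * q : ℤ) : ℚ) < (((x + 1 - r) * p : ℤ) : ℚ) := by push_cast; exact h2
      have h1'' := Int.cast_le.mp h1'
      have h2'' := Int.cast_lt.mp h2'
      constructor <;> nlinarith
    · rintro ⟨h1, h2⟩
      have h1' : (x - r) * p ≤ n * q := by nlinarith
      have h2' : n * q < (x + 1 - r) * p := by nlinarith
      exact ⟨by exact_mod_cast h1', by exact_mod_cast h2'⟩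
  simp only [beattySet, Set.mem_range, key]
  have hdm := Int.emod_add_mul_ediv (-(p * (x - r))) q
  constructor
  · rintro ⟨n, h1, h2⟩
    have : (-(p * (x - r))) % q = (-(p * (x - r)) + n * q) % q := by simp
    rw [this]
    have h3 := Int.emod_add_mul_ediv (-(p * (x - r)) + n * q) q
    have h4 : 0 ≤ q * ((-(p * (x - r)) + n * q) / q) :=
      mul_nonneg hq.le (Int.ediv_nonneg (by linarith) hq.le)
    linarith
  · intro h
    have h0 := Int.emod_nonneg (-(p * (x - r))) hq.ne'
    exact ⟨-(-(p * (x - r)) / q), by linarith, by linarith⟩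

/-- The least nonnegative residue of `-p (x - r)` modulo `q`. -/
def sawtooth {q : ℕ} (p r x : ZMod q) : ℕ := (-(p * (x - r))).val

open Classical in
-- One step in `x` lowers the residue by `p`, and it wraps around by `q` exactly when the residue is
-- below `p`, that is, on the Beatty set.
theorem beatty_indicator_mul {q : ℕ} {p : ℤ} (r x : ℤ) (hp : 0 < p) (hpq : p < q) :
    (q : ℤ) * ((beattySet (q : ℤ) p r).indicator (fun _ => (1 : ℕ)) x : ℕ) =
      p + sawtooth (p : ZMod q) r ((x + 1 : ℤ) : ZMod q) - sawtooth (p : ZMod q) r (x : ZMod q) := by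
  have hq : (0 : ℤ) < q := hp.trans hpq
  have : NeZero q := ⟨by rintro rfl; simp at hq⟩
  have e : ∀ y : ℤ, (sawtooth (p : ZMod q) r (y : ZMod q) : ℤ) = (-(p * (y - r))) % q := by
    intro y
    rw [sawtooth, ← ZMod.val_intCast]
    push_cast
    rfl
  rw [e, e, Set.indicator_apply, mem_beattySet_iff r x hp hq]
  have e2 : -(p * (x + 1 - r)) = -(p * (x - r)) - p := by ring
  rw [e2]
  have h0 := Int.emod_nonneg (-(p * (x - r))) hq.ne'
  have h1 := Int.emod_lt_of_pos (-(p * (x - r))) hq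
  generalize -(p * (x - r)) = t at *
  have h2 : (t - p) % q = (t % q - p) % q := by simp
  rw [h2]
  split_ifs with h
  · have : (t % q - p) % q = (t % q - p + q) % q := by simp
    rw [this, Int.emod_eq_of_lt (by linarith) (by linarith)]
    push_cast; ring
  · rw [Int.emod_eq_of_lt (by linarith) (by linarith)]
    push_cast; ring

theorem isPerfectCovering_iff {q m : ℕ} {p : Fin m → ℤ} (r : Fin m → ℤ) (hq : 0 < q)
    (hp : ∀ k, 0 < p k) (hpq : ∀ k, p k < q) :
    IsPerfectCovering (fun k => beattySet (q : ℤ) (p k) (r k)) ↔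
      ∀ x : ZMod q, ∑ k, sawtooth (p k : ZMod q) (r k) (x + 1) =
        ∑ k, sawtooth (p k : ZMod q) (r k) x := by
  classical
  have : NeZero q := ⟨hq.ne'⟩
  have hqZ : (0 : ℤ) < q := by exact_mod_cast hq
  set F : ZMod q → ℤ := fun x => ∑ k, (sawtooth (p k : ZMod q) (r k) x : ℤ) with hF
  have key : ∀ x : ℤ, (q : ℤ) * ((∑ k, (beattySet (q : ℤ) (p k) (r k)).indicator
      (fun _ => (1 : ℕ)) x : ℕ) : ℤ) = ∑ k, p k + F ((x + 1 : ℤ) : ZMod q) - F (x : ZMod q) := by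
    intro x
    rw [Nat.cast_sum, Finset.mul_sum, hF, ← Finset.sum_add_distrib, ← Finset.sum_sub_distrib]
    exact Finset.sum_congr rfl fun k _ => beatty_indicator_mul (r k) x (hp k) (hpq k)
  have hFe : (∀ x : ZMod q, ∑ k, sawtooth (p k : ZMod q) (r k) (x + 1) =
        ∑ k, sawtooth (p k : ZMod q) (r k) x) ↔ ∀ x : ZMod q, F (x + 1) = F x := by
    refine forall_congr' fun x => ?_
    simp only [hF]
    norm_cast
  rw [hFe]
  constructor
  · rintro ⟨c, hc⟩
    have step : ∀ x : ZMod q, F (x + 1) = F x + (q * c - ∑ k, p k) := by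
      intro x
      obtain ⟨y, rfl⟩ := ZMod.intCast_surjective x
      have h := key y
      have hcy : (∑ k, (beattySet (q : ℤ) (p k) (r k)).indicator (fun _ => (1 : ℕ)) y) = c := hc y
      rw [hcy] at h
      push_cast at h
      linarith
    -- The increment of `F` is a constant; going once around `ZMod q` shows that it is zero.
    have iter : ∀ n : ℕ, F (n : ZMod q) = F 0 + n * (q * c - ∑ k, p k) := by
      intro n
      induction n with
      | zero => simp
      | succ n ih => push_cast; rw [step, ih]; ring
    have h0 := iter q
    rw [ZMod.natCast_self] at h0
    have h1 : (q : ℤ) * (q * c - ∑ k, p k) = 0 := by linarith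
    have h2 : (q * c - ∑ k, p k : ℤ) = 0 := by
      rcases mul_eq_zero.mp h1 with h | h
      · exact absurd h hqZ.ne'
      · exact h
    intro x
    rw [step, h2, add_zero]
  · intro h
    refine ⟨∑ k, (beattySet (q : ℤ) (p k) (r k)).indicator (fun _ => (1 : ℕ)) 0, fun x => ?_⟩
    have hx := key x
    have h0 := key 0
    have hx1 := h (x : ZMod q)
    have h01 := h ((0 : ℤ) : ZMod q)
    push_cast at hx h0 hx1 h01
    rw [zero_add] at h01
    rw [hx1] at hx
    rw [h01] at h0
    have : (q : ℤ) * ((∑ k, (beattySet (q : ℤ) (p k) (r k)).indicator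
      (fun _ => (1 : ℕ)) x : ℕ) : ℤ) = (q : ℤ) * ((∑ k, (beattySet (q : ℤ) (p k) (r k)).indicator
      (fun _ => (1 : ℕ)) 0 : ℕ) : ℤ) := by push_cast; linarith
    exact_mod_cast mul_left_cancel₀ hqZ.ne' this

/-! ### Binary families give perfect coverings -/

/-- With `h = (q + 1) / 2`, both sides depend only on whether adding `h` to the residue of `a - h`
wraps around. The difference of values at `2 a` and `a` is what telescopes along powers of two. -/
theorem two_mul_val_sub_half {q : ℕ} [NeZero q] {h : ZMod q} (hh : 2 * h = 1) (hq : 1 < q)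
    (a : ZMod q) :
    (2 * (a - h).val : ℤ) = 2 * (2 * a).val - 2 * a.val + q - 1 := by
  have hH : 2 * h.val = q + 1 := by
    have h1 : ((2 * h.val : ℕ) : ZMod q) = ((1 : ℕ) : ZMod q) := by
      push_cast; rw [ZMod.natCast_zmod_val, hh]
    rw [ZMod.natCast_eq_natCast_iff', Nat.mod_eq_of_lt hq] at h1
    have hlt := ZMod.val_lt h
    have := Nat.div_add_mod (2 * h.val) q
    rw [h1] at this
    have h2 : 2 * h.val / q < 2 := by
      rw [Nat.div_lt_iff_lt_mul (by omega)]; omega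
    interval_cases hd : 2 * h.val / q <;> omega
  set u := (a - h) with hu
  have ha : a = ((u.val + h.val : ℕ) : ZMod q) := by push_cast; simp [hu]
  have h2a : 2 * a = ((2 * u.val + 1 : ℕ) : ZMod q) := by
    push_cast; rw [ZMod.natCast_zmod_val, hu, ← hh]; ring
  have hul := ZMod.val_lt u
  rw [h2a, ha, ZMod.val_natCast, ZMod.val_natCast]
  by_cases hc : u.val + h.val < q
  · rw [Nat.mod_eq_of_lt hc, Nat.mod_eq_of_lt (by omega)]
    push_cast; omega
  · rw [Nat.mod_eq_sub_mod (by omega : q ≤ u.val + h.val),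
      Nat.mod_eq_of_lt (by omega : u.val + h.val - q < q),
      Nat.mod_eq_sub_mod (by omega : q ≤ 2 * u.val + 1),
      Nat.mod_eq_of_lt (by omega : 2 * u.val + 1 - q < q)]
    omega

/-- The sawtooth sum of a binary family does not depend on the point. -/
theorem two_mul_sum_val_sub_half {q m : ℕ} [NeZero q] {h : ZMod q} (hh : 2 * h = 1) (hq : 1 < q)
    (hm : (2 : ZMod q) ^ m = 1) (z : ZMod q) :
    (2 * ∑ j ∈ Finset.range m, (2 ^ j * z - h).val : ℤ) = m * (q - 1) := by
  have : ∀ j ∈ Finset.range m, (2 * (2 ^ j * z - h).val : ℤ) =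
      2 * (((2 ^ (j + 1) * z : ZMod q).val : ℤ) - (2 ^ j * z : ZMod q).val) + (q - 1) := by
    intro j _
    rw [two_mul_val_sub_half hh hq, pow_succ' 2 j, mul_assoc]
    ring
  rw [Nat.cast_sum, Finset.mul_sum, Finset.sum_congr rfl this, Finset.sum_add_distrib,
    ← Finset.mul_sum, Finset.sum_range_sub (fun j => ((2 ^ j * z : ZMod q).val : ℤ)), hm]
  simp [mul_sub]

theorem sawtooth_sum_of_isBinaryFamily {q m : ℕ} {p r : Fin m → ℤ} (hq : 3 ≤ q)
    (hm : 0 < m) (hord : orderOf (2 : ZMod q) = m) (hb : IsBinaryFamily q p r) (x : ZMod q) :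
    (2 * ∑ k, sawtooth (p k : ZMod q) (r k) x : ℤ) = m * (q - 1) := by
  have : NeZero q := ⟨by omega⟩
  obtain ⟨σ, δ, δ', γ, -, hδ, h⟩ := hb
  have h2m : (2 : ZMod q) ^ m = 1 := hord ▸ pow_orderOf_eq_one _
  have hδ' : (δ : ZMod q) * δ' = 1 := by
    have := (ZMod.intCast_eq_intCast_iff _ _ _).mpr hδ
    push_cast at this; exact this
  -- The inverse of two is `2 ^ (m - 1)`, which is exactly the offset produced by multiplying `p_k`
  -- with the `δ'` part of `r_k`.
  have hh : (2 : ZMod q) * 2 ^ (m - 1) = 1 := by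
    rw [← pow_succ', Nat.sub_add_cancel hm, h2m]
  rw [← two_mul_sum_val_sub_half hh (by omega) h2m (-(δ * (x - γ))), ← Finset.sum_range_reflect,
    Finset.sum_range, ← Equiv.sum_comp σ]
  congr 2
  refine Finset.sum_congr rfl fun k _ => ?_
  obtain ⟨h1, h2⟩ := h k
  have h1' := (ZMod.intCast_eq_intCast_iff _ _ _).mpr h1
  have h2' := (ZMod.intCast_eq_intCast_iff _ _ _).mpr h2
  push_cast at h1' h2'
  rw [sawtooth, h1', h2']
  have hpow : (2 : ZMod q) ^ (m - 1) = 2 ^ (m - 1 - (k : ℕ)) * 2 ^ (k : ℕ) := by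
    rw [← pow_add]; congr 1; omega
  congr 2
  rw [hpow]
  linear_combination (-(2 : ZMod q) ^ (m - 1 - (k : ℕ)) * 2 ^ (k : ℕ)) * hδ'

/-! ### Fourier coefficients of sawtooth functions -/

open ZMod in
-- The sawtooth has period `t = q / gcd(p, q)`, and translation by `t` multiplies the coefficient by
-- a character value that is not 1.
theorem fourier_sawtooth_eq_zero {q : ℕ} [NeZero q] (p j : ℤ) (r : ZMod q)
    (h : ¬ ((Int.gcd p q : ℕ) : ℤ) ∣ j) :
    ∑ x : ZMod q, (sawtooth (p : ZMod q) r x : ℂ) * stdAddChar ((j : ZMod q) * x) = 0 := by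
  set d := Int.gcd p q with hd
  have hq0 : (q : ℤ) ≠ 0 := by exact_mod_cast NeZero.ne q
  obtain ⟨p', hp'⟩ : (d : ℤ) ∣ p := Int.gcd_dvd_left ..
  obtain ⟨t, ht⟩ : (d : ℤ) ∣ q := Int.gcd_dvd_right ..
  have hpt : (p : ZMod q) * t = 0 := by
    rw [hp']
    have : (((d * t : ℤ)) : ZMod q) = 0 := by rw [← ht]; simp
    push_cast at this ⊢
    linear_combination (p' : ZMod q) * this
  have hne : (stdAddChar ((j : ZMod q) * (t : ZMod q)) : ℂ) ≠ 1 := by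
    intro h1
    rw [← (stdAddChar (N := q)).map_zero_eq_one, injective_stdAddChar.eq_iff, ← Int.cast_mul,
      ZMod.intCast_zmod_eq_zero_iff_dvd] at h1
    have ht0 : t ≠ 0 := by rintro rfl; simp at ht; exact hq0 (by exact_mod_cast ht)
    rw [ht] at h1
    exact h (Int.dvd_of_mul_dvd_mul_right ht0 h1)
  have key : ∑ x : ZMod q, (sawtooth (p : ZMod q) r x : ℂ) * stdAddChar ((j : ZMod q) * x) =
      stdAddChar ((j : ZMod q) * (t : ZMod q)) *
        ∑ x : ZMod q, (sawtooth (p : ZMod q) r x : ℂ) * stdAddChar ((j : ZMod q) * x) := by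
    conv_lhs => rw [← Equiv.sum_comp (Equiv.addRight (t : ZMod q))]
    rw [Finset.mul_sum]
    refine Finset.sum_congr rfl fun x _ => ?_
    have hs : sawtooth (p : ZMod q) r (x + t) = sawtooth (p : ZMod q) r x := by
      unfold sawtooth
      congr 1
      linear_combination -hpt
    simp only [Equiv.coe_addRight]
    rw [hs, mul_add, AddChar.map_add_eq_mul]
    ring
  have : (1 - stdAddChar ((j : ZMod q) * (t : ZMod q))) * ∑ x : ZMod q,
      (sawtooth (p : ZMod q) r x : ℂ) * stdAddChar ((j : ZMod q) * x) = 0 := by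
    rw [sub_mul, ← key]; ring
  rcases mul_eq_zero.mp this with h1 | h1
  · exact absurd (sub_eq_zero.mp h1).symm hne
  · exact h1

/-- Multiples of `d` cannot jump over `q`, because `d ∣ q`; the only wrap-around lands exactly on
zero. -/
theorem val_add_of_dvd {q d : ℕ} [NeZero q] (hd : 0 < d) (hdq : d ∣ q) (hlt : d < q) (y : ZMod q)
    (hy : (d : ZMod q) ∣ y) :
    ((y + d).val : ℤ) = y.val + d - if y = -d then (q : ℤ) else 0 := by
  have hyd : d ∣ y.val := by
    obtain ⟨c, rfl⟩ := hy
    rw [ZMod.val_mul, Nat.dvd_mod_iff hdq, ZMod.val_natCast, Nat.mod_eq_of_lt hlt]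
    exact dvd_mul_right _ _
  have hdv : (d : ZMod q).val = d := by rw [ZMod.val_natCast, Nat.mod_eq_of_lt hlt]
  have hyl := ZMod.val_lt y
  have hle : y.val + d ≤ q := by
    obtain ⟨a, ha⟩ := hyd
    obtain ⟨c, hc⟩ := hdq
    have hac : a < c := lt_of_mul_lt_mul_left (ha ▸ hc ▸ hyl : d * a < d * c) (Nat.zero_le d)
    calc y.val + d = d * (a + 1) := by rw [ha]; ring
      _ ≤ d * c := Nat.mul_le_mul_left _ hac
      _ = q := hc.symm
  have hiff : y = -d ↔ y.val + d = q := by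
    constructor
    · intro h
      have h0 : ((y.val + d : ℕ) : ZMod q) = 0 := by
        push_cast; rw [ZMod.natCast_zmod_val, h]; ring
      rw [ZMod.natCast_eq_zero_iff] at h0
      exact le_antisymm hle (Nat.le_of_dvd (by omega) h0)
    · intro h
      have h0 : ((y.val + d : ℕ) : ZMod q) = 0 := by rw [h]; simp
      push_cast at h0
      rw [ZMod.natCast_zmod_val] at h0
      linear_combination h0
  rw [ZMod.val_add, hdv]
  split_ifs with h
  · have h' := hiff.mp h
    rw [h', Nat.mod_self]
    omega
  · rw [Nat.mod_eq_of_lt (lt_of_le_of_ne hle (fun h' => h (hiff.mpr h')))]; push_cast; ring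

open ZMod in
-- Summation by parts: translation by `b` changes the sawtooth by the constant `d`, except for a
-- jump of `q` on a coset of the kernel of `d`. The constant contributes nothing at `j ≠ 0`, and the
-- character is constant on the coset since `d ∣ j`. The right side depends on `p` and `r` only
-- through `d` and the phase.
theorem fourier_sawtooth_mul {q d : ℕ} [NeZero q] (hd : 0 < d) (hdq : d ∣ q) (hlt : d < q)
    {p b j : ZMod q} (r : ZMod q) (hb : p * b = d) (hp : (d : ZMod q) ∣ p)
    (hj : (d : ZMod q) ∣ j) (hj0 : j ≠ 0) :
    (stdAddChar (j * b) - 1) * ∑ x : ZMod q, (sawtooth p r x : ℂ) * stdAddChar (j * x) =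
      -((q : ℂ) * (Finset.univ.filter fun y : ZMod q => (d : ZMod q) * y = 0).card) *
        stdAddChar (j * (r + b)) := by
  classical
  have h1 : stdAddChar (j * b) * ∑ x : ZMod q, (sawtooth p r x : ℂ) * stdAddChar (j * x) =
      ∑ x : ZMod q, (sawtooth p r (x - b) : ℂ) * stdAddChar (j * x) := by
    conv_rhs => rw [← Equiv.sum_comp (Equiv.addRight b)]
    rw [Finset.mul_sum]
    refine Finset.sum_congr rfl fun x _ => ?_
    simp only [Equiv.coe_addRight, add_sub_cancel_right]
    rw [mul_add, AddChar.map_add_eq_mul]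
    ring
  have h2 : ∀ x : ZMod q, (sawtooth p r (x - b) : ℂ) = sawtooth p r x + d -
      if p * (x - r) = d then (q : ℂ) else 0 := by
    intro x
    have e : -(p * (x - b - r)) = -(p * (x - r)) + d := by linear_combination hb
    have h := val_add_of_dvd hd hdq hlt (-(p * (x - r)))
      ((hp.mul_right _).neg_right)
    rw [← e] at h
    simp only [neg_inj] at h
    have h' := congrArg (Int.cast : ℤ → ℂ) h
    push_cast at h'
    exact h'
  have hsum : ∑ x : ZMod q, stdAddChar (j * x) = (0 : ℂ) := by
    simpa [AddChar.mulShift_apply] using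
      AddChar.sum_eq_zero_of_ne_one (isPrimitive_stdAddChar q hj0)
  have h3 : ∑ x : ZMod q, (if p * (x - r) = d then (q : ℂ) else 0) * stdAddChar (j * x) =
      (q : ℂ) * (Finset.univ.filter fun y : ZMod q => (d : ZMod q) * y = 0).card *
        stdAddChar (j * (r + b)) := by
    rw [← Equiv.sum_comp (Equiv.addRight (r + b))]
    have : ∀ y : ZMod q, (if p * (y + (r + b) - r) = d then (q : ℂ) else 0) *
        stdAddChar (j * (y + (r + b))) =
        if (d : ZMod q) * y = 0 then (q : ℂ) * stdAddChar (j * (r + b)) else 0 := by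
      intro y
      have hiff : p * (y + (r + b) - r) = d ↔ (d : ZMod q) * y = 0 := by
        constructor
        · intro h
          linear_combination b * h - (y + b) * hb
        · intro h
          obtain ⟨p', hp'⟩ := hp
          rw [← hb, hp']
          linear_combination p' * h
      by_cases h : (d : ZMod q) * y = 0
      · rw [if_pos h, if_pos (hiff.mpr h)]
        obtain ⟨j', hj'⟩ := hj
        congr 2
        rw [hj']
        linear_combination j' * h
      · rw [if_neg h, if_neg (fun h' => h (hiff.mp h')), zero_mul]
    refine (Finset.sum_congr rfl fun y _ => this y).trans ?_
    rw [← Finset.sum_filter, Finset.sum_const,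
      nsmul_eq_mul]
    ring
  rw [sub_mul, one_mul, h1, neg_mul, ← h3]
  simp only [h2]
  rw [← Finset.sum_sub_distrib, ← Finset.sum_neg_distrib]
  have h4 : ∑ x : ZMod q, (d : ℂ) * stdAddChar (j * x) = 0 := by
    rw [← Finset.mul_sum, hsum, mul_zero]
  rw [← sub_eq_zero, ← Finset.sum_sub_distrib, ← h4]
  refine Finset.sum_congr rfl fun x _ => ?_
  ring

open ZMod in
/-- The Fourier coefficients of a constant sum of sawtooth functions at a frequency `p k` whose
greatest common divisor with `q` is minimal. -/
theorem sum_fourier_class {q : ℕ} [NeZero q] {ι : Type*} [Fintype ι] (p r : ι → ℤ)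
    (b : ι → ZMod q) (hp : ∀ i, 0 < p i) (hpq : ∀ i, p i < q)
    (hb : ∀ i, (p i : ZMod q) * b i = (Int.gcd (p i) q : ℕ))
    (hF : ∀ x : ZMod q, ∑ i, sawtooth (p i : ZMod q) (r i) (x + 1) =
      ∑ i, sawtooth (p i : ZMod q) (r i) x) (k : ι)
    (hmin : ∀ i, Int.gcd (p i) q ∣ Int.gcd (p k) q → Int.gcd (p i) q = Int.gcd (p k) q) :
    ∑ i with Int.gcd (p i) q = Int.gcd (p k) q,
      stdAddChar ((p k : ZMod q) * ((r i : ZMod q) + b i)) / (stdAddChar ((p k : ZMod q) * b i) - 1) =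
        (0 : ℂ) := by
  classical
  have hconst : ∀ x : ZMod q, ∑ i, sawtooth (p i : ZMod q) (r i) x =
      ∑ i, sawtooth (p i : ZMod q) (r i) 0 := by
    intro x
    rw [← ZMod.natCast_zmod_val x]
    induction x.val with
    | zero => simp
    | succ n ih => push_cast; rw [hF, ih]
  set d := Int.gcd (p k) q with hd
  have hpos : 0 < d := Int.gcd_pos_of_ne_zero_left _ (hp k).ne'
  have hdq : d ∣ q := by exact_mod_cast Int.gcd_dvd_right (p k) q
  have hdle : (d : ℤ) ≤ p k := Int.le_of_dvd (hp k) (Int.gcd_dvd_left ..)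
  have hlt : d < q := by have := hpq k; omega
  have hpk0 : (p k : ZMod q) ≠ 0 := by
    rw [Ne, ZMod.intCast_zmod_eq_zero_iff_dvd]
    intro h
    have := Int.le_of_dvd (hp k) h
    have := hpq k
    omega
  have hd0 : (d : ZMod q) ≠ 0 := by
    rw [Ne, ZMod.natCast_eq_zero_iff]
    exact fun h => absurd (Nat.le_of_dvd hpos h) (by omega)
  have hdvd : ∀ i, Int.gcd (p i) q = d → (d : ZMod q) ∣ (p i : ZMod q) := by
    intro i hi
    obtain ⟨c, hc⟩ : (d : ℤ) ∣ p i := hi ▸ Int.gcd_dvd_left (p i) q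
    exact ⟨c, by rw [hc]; push_cast; ring⟩
  have htot : ∑ i, ∑ x : ZMod q, (sawtooth (p i : ZMod q) (r i) x : ℂ) *
      stdAddChar ((p k : ZMod q) * x) = 0 := by
    rw [Finset.sum_comm]
    have : ∀ x : ZMod q, ∑ i, (sawtooth (p i : ZMod q) (r i) x : ℂ) *
        stdAddChar ((p k : ZMod q) * x) =
        ((∑ i, sawtooth (p i : ZMod q) (r i) 0 : ℕ) : ℂ) * stdAddChar ((p k : ZMod q) * x) := by
      intro x
      rw [← Finset.sum_mul, ← hconst x]
      push_cast; rfl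
    rw [Finset.sum_congr rfl fun x _ => this x, ← Finset.mul_sum]
    have hsum : ∑ x : ZMod q, stdAddChar ((p k : ZMod q) * x) = (0 : ℂ) := by
      simpa [AddChar.mulShift_apply] using
        AddChar.sum_eq_zero_of_ne_one (isPrimitive_stdAddChar q hpk0)
    rw [hsum, mul_zero]
  set M : ℕ := (Finset.univ.filter fun y : ZMod q => (d : ZMod q) * y = 0).card with hM
  have hM0 : (-((q : ℂ) * M)) ≠ 0 := by
    have h1 : (q : ℂ) ≠ 0 := by exact_mod_cast NeZero.ne q
    have h2 : M ≠ 0 := by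
      rw [hM, Finset.card_ne_zero]
      exact ⟨0, by simp⟩
    exact neg_ne_zero.mpr (mul_ne_zero h1 (by exact_mod_cast h2))
  have hterm : ∀ i, ∑ x : ZMod q, (sawtooth (p i : ZMod q) (r i) x : ℂ) *
      stdAddChar ((p k : ZMod q) * x) = if Int.gcd (p i) q = d then
        -((q : ℂ) * M) * (stdAddChar ((p k : ZMod q) * ((r i : ZMod q) + b i)) /
          (stdAddChar ((p k : ZMod q) * b i) - 1)) else 0 := by
    intro i
    split_ifs with hi
    · have hne : stdAddChar ((p k : ZMod q) * b i) - 1 ≠ 0 := by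
        rw [sub_ne_zero]
        intro h1
        rw [← (stdAddChar (N := q)).map_zero_eq_one, injective_stdAddChar.eq_iff] at h1
        obtain ⟨c, hc⟩ := hdvd i hi
        have hbi := hb i
        have hbk := hb k
        rw [hi] at hbi
        rw [← hd] at hbk
        apply hd0
        -- Multiplying `p_k b_i = 0` by `c b_k` gives `d c b_i = p_i b_i = d`, so `d = 0`.
        linear_combination (c * b k) * h1 - (c * b i) * hbk - hbi + b i * hc
      rw [mul_div_assoc', eq_div_iff hne, mul_comm]
      exact fourier_sawtooth_mul hpos hdq hlt _ (hi ▸ hb i) (hdvd i hi) (hdvd k rfl) hpk0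
    · refine fourier_sawtooth_eq_zero _ _ _ fun h => hi (hmin i ?_)
      have h2 : ((Int.gcd (p i) q : ℕ) : ℤ) ∣ q := Int.gcd_dvd_right ..
      exact_mod_cast Int.dvd_coe_gcd h h2
  rw [Finset.sum_congr rfl fun i _ => hterm i, ← Finset.sum_filter, ← Finset.mul_sum] at htot
  exact (mul_eq_zero.mp htot).resolve_left hM0

/-! ### Moduli of the terms and classes of equal gcd -/

open ZMod in
theorem norm_stdAddChar_sub_one {q : ℕ} [NeZero q] (a : ZMod q) :
    ‖(stdAddChar a : ℂ) - 1‖ = 2 * |Real.sin (Real.pi * a.valMinAbs.natAbs / q)| := by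
  conv_lhs => rw [← ZMod.coe_valMinAbs a]
  rw [stdAddChar_coe]
  have e : (2 * Real.pi * Complex.I * (a.valMinAbs : ℤ) / q : ℂ) =
      Complex.I * ((2 * Real.pi * a.valMinAbs / q : ℝ) : ℂ) := by
    push_cast; ring
  rw [e, Complex.norm_exp_I_mul_ofReal_sub_one, norm_mul, Real.norm_eq_abs, Real.norm_eq_abs]
  have e2 : (2 * Real.pi * (a.valMinAbs : ℝ) / q) / 2 = Real.pi * a.valMinAbs / q := by ring
  rw [e2, abs_two]
  congr 1
  rcases Int.natAbs_eq a.valMinAbs with h | h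
  · have h' : (a.valMinAbs : ℝ) = a.valMinAbs.natAbs := by
      rw [← Int.cast_natCast, ← h]
    rw [h']
  · have h' : (a.valMinAbs : ℝ) = -a.valMinAbs.natAbs := by
      rw [← Int.cast_natCast, ← Int.cast_neg, ← h]
    rw [h', mul_neg, neg_div, Real.sin_neg, abs_neg]

theorem pi_mul_div_mem {q a : ℕ} (hq : 0 < q) (ha : a ≤ q / 2) :
    0 ≤ Real.pi * a / q ∧ Real.pi * a / q ≤ Real.pi / 2 := by
  have hq' : (0 : ℝ) < q := by exact_mod_cast hq
  have h2 : (2 * a : ℝ) ≤ q := by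
    have : 2 * a ≤ q := by omega
    exact_mod_cast this
  refine ⟨by positivity, ?_⟩
  rw [div_le_div_iff₀ hq' two_pos]
  nlinarith [Real.pi_pos]

theorem sin_pi_mul_div_lt {q a b : ℕ} (hq : 0 < q) (hab : a < b) (hb : b ≤ q / 2) :
    Real.sin (Real.pi * a / q) < Real.sin (Real.pi * b / q) := by
  have hq' : (0 : ℝ) < q := by exact_mod_cast hq
  have ha1 := pi_mul_div_mem hq (hab.le.trans hb)
  have hb1 := pi_mul_div_mem hq hb
  refine Real.sin_lt_sin_of_lt_of_le_pi_div_two (by linarith [Real.pi_pos]) hb1.2 ?_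
  have : (a : ℝ) < b := by exact_mod_cast hab
  gcongr

theorem sin_pi_mul_div_nonneg {q a : ℕ} (hq : 0 < q) (ha : a ≤ q / 2) :
    0 ≤ Real.sin (Real.pi * a / q) := by
  have h := pi_mul_div_mem hq ha
  exact Real.sin_nonneg_of_nonneg_of_le_pi h.1 (by linarith [Real.pi_pos])

open ZMod in
-- The modulus is twice a sine of an angle in `[0, π / 2]`, where the sine is injective.
theorem eq_or_eq_neg_of_norm_stdAddChar_sub_one_eq {q : ℕ} [NeZero q] {a b : ZMod q}
    (h : ‖(stdAddChar a : ℂ) - 1‖ = ‖(stdAddChar b : ℂ) - 1‖) : a = b ∨ a = -b := by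
  have hq : 0 < q := NeZero.pos q
  rw [norm_stdAddChar_sub_one, norm_stdAddChar_sub_one,
    abs_of_nonneg (sin_pi_mul_div_nonneg hq (natAbs_valMinAbs_le a)),
    abs_of_nonneg (sin_pi_mul_div_nonneg hq (natAbs_valMinAbs_le b))] at h
  rw [← natAbs_valMinAbs_eq_natAbs_valMinAbs]
  rcases lt_trichotomy a.valMinAbs.natAbs b.valMinAbs.natAbs with hlt | heq | hgt
  · have := sin_pi_mul_div_lt hq hlt (natAbs_valMinAbs_le b)
    linarith
  · exact heq
  · have := sin_pi_mul_div_lt hq hgt (natAbs_valMinAbs_le a)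
    linarith

open ZMod in
/-- A class of indices with the same minimal greatest common divisor has at least three members. -/
theorem three_le_card_class {q : ℕ} [NeZero q] {ι : Type*} [Fintype ι] [DecidableEq ι]
    (p r : ι → ℤ) (b : ι → ZMod q) (hp : ∀ i, 0 < p i) (hpq : ∀ i, p i < q)
    (hne : ∀ i k, i ≠ k → (p i : ZMod q) ≠ p k ∧ (p i : ZMod q) ≠ -p k)
    (hb : ∀ i, (p i : ZMod q) * b i = (Int.gcd (p i) q : ℕ))
    (hF : ∀ x : ZMod q, ∑ i, sawtooth (p i : ZMod q) (r i) (x + 1) =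
      ∑ i, sawtooth (p i : ZMod q) (r i) x) (k : ι)
    (hmin : ∀ i, Int.gcd (p i) q ∣ Int.gcd (p k) q → Int.gcd (p i) q = Int.gcd (p k) q) :
    3 ≤ (Finset.univ.filter fun i => Int.gcd (p i) q = Int.gcd (p k) q).card := by
  have hsum := sum_fourier_class p r b hp hpq hb hF k hmin
  set d := Int.gcd (p k) q with hd
  have hpos : 0 < d := Int.gcd_pos_of_ne_zero_left _ (hp k).ne'
  have hdle : (d : ℤ) ≤ p k := Int.le_of_dvd (hp k) (Int.gcd_dvd_left ..)
  have hlt : d < q := by have := hpq k; omega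
  have hd0 : (d : ZMod q) ≠ 0 := by
    rw [Ne, ZMod.natCast_eq_zero_iff]
    exact fun h => absurd (Nat.le_of_dvd hpos h) (by omega)
  have hbk : (p k : ZMod q) * b k = d := hb k
  have hk1 : (stdAddChar (d : ZMod q) : ℂ) - 1 ≠ 0 := by
    rw [sub_ne_zero, ← (stdAddChar (N := q)).map_zero_eq_one]
    exact fun h => hd0 (injective_stdAddChar h)
  have hnorm : ∀ y : ZMod q, ‖(stdAddChar y : ℂ)‖ = 1 := fun y => AddChar.norm_apply _ _
  by_contra hcard
  set S := Finset.univ.filter fun i => Int.gcd (p i) q = d with hS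
  have hkS : k ∈ S := by simp [hS, hd]
  rw [← Finset.add_sum_erase _ _ hkS, hbk] at hsum
  have hle : (S.erase k).card ≤ 1 := by rw [Finset.card_erase_of_mem hkS]; omega
  have hne0 : (stdAddChar ((p k : ZMod q) * ((r k : ZMod q) + b k)) : ℂ) /
      (stdAddChar (d : ZMod q) - 1) ≠ 0 := by
    rw [← norm_ne_zero_iff, norm_div, hnorm]
    exact div_ne_zero one_ne_zero (norm_ne_zero_iff.mpr hk1)
  have : Nonempty ι := ⟨k⟩
  rcases Finset.card_le_one_iff_subset_singleton.mp hle with ⟨i, hi⟩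
  rcases Finset.subset_singleton_iff.mp hi with h0 | h1
  · rw [h0, Finset.sum_empty, add_zero] at hsum
    exact hne0 hsum
  · have hiS : i ∈ S.erase k := by rw [h1]; exact Finset.mem_singleton_self i
    rw [h1, Finset.sum_singleton] at hsum
    -- Two terms that cancel have equal moduli, which forces `p_k b_i = ± d` and so `p_i = ± p_k`.
    have hnn := congrArg norm (eq_neg_of_add_eq_zero_left hsum)
    rw [norm_neg, norm_div, norm_div, hnorm, hnorm, one_div, one_div, inv_inj] at hnn
    have hid : Int.gcd (p i) q = d := (Finset.mem_filter.mp (Finset.mem_of_mem_erase hiS)).2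
    have hik := Finset.ne_of_mem_erase hiS
    obtain ⟨c, hc⟩ : (d : ℤ) ∣ p i := hid ▸ Int.gcd_dvd_left (p i) q
    obtain ⟨e, he⟩ : (d : ℤ) ∣ p k := Int.gcd_dvd_left (p k) q
    have hc' : (p i : ZMod q) = d * c := by rw [hc]; push_cast; ring
    have he' : (p k : ZMod q) = d * e := by rw [he]; push_cast; ring
    have hbi := hb i
    rw [hid] at hbi
    rcases eq_or_eq_neg_of_norm_stdAddChar_sub_one_eq hnn with h | h
    · refine (hne i k hik).1 ?_
      linear_combination (c : ZMod q) * h + hc' + e * hbi - (e * b i) * hc' + (c * b i - 1) * he'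
    · refine (hne i k hik).2 ?_
      linear_combination (c : ZMod q) * h + hc' - e * hbi + (e * b i) * hc' -
        (c * b i - 1) * he'

/-- A unique divisibility-minimal class of greatest common divisors is the class of `1`. -/
theorem three_le_card_coprime {q m : ℕ} (hm : 0 < m) (hm5 : m ≤ 5) (p : Fin m → ℤ)
    (hgcd : gcd (q : ℤ) (Finset.univ.gcd p) = 1)
    (hclass : ∀ k, (∀ i, Int.gcd (p i) q ∣ Int.gcd (p k) q →
      Int.gcd (p i) q = Int.gcd (p k) q) →
      3 ≤ (Finset.univ.filter fun i => Int.gcd (p i) q = Int.gcd (p k) q).card)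
    (hpos : ∀ i, 0 < Int.gcd (p i) q) :
    3 ≤ (Finset.univ.filter fun i => Int.gcd (p i) q = 1).card := by
  have : Nonempty (Fin m) := ⟨⟨0, hm⟩⟩
  obtain ⟨k, -, hk⟩ := Finset.exists_min_image Finset.univ (fun i => Int.gcd (p i) q)
    Finset.univ_nonempty
  have hck := hclass k (fun i hi => le_antisymm (Nat.le_of_dvd (hpos k) hi) (hk i (by simp)))
  have hall : ∀ i, Int.gcd (p k) q ∣ Int.gcd (p i) q := by
    by_contra hcon
    push Not at hcon
    obtain ⟨l, hl⟩ := hcon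
    -- A divisor of a gcd not divisible by that of `k` is not divisible by it either, so the least
    -- such gcd is again minimal for divisibility. Two disjoint classes of size three do not fit
    -- into five indices.
    obtain ⟨k', hk'm, hk'⟩ := Finset.exists_min_image
      (Finset.univ.filter fun i => ¬ Int.gcd (p k) q ∣ Int.gcd (p i) q)
      (fun i => Int.gcd (p i) q) ⟨l, by simpa using hl⟩
    rw [Finset.mem_filter] at hk'm
    have hck' := hclass k' (fun i hi => le_antisymm (Nat.le_of_dvd (hpos k') hi)
      (hk' i (by simpa using fun h => hk'm.2 (h.trans hi))))
    have hdisj : Disjoint (Finset.univ.filter fun i => Int.gcd (p i) q = Int.gcd (p k) q)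
        (Finset.univ.filter fun i => Int.gcd (p i) q = Int.gcd (p k') q) := by
      rw [Finset.disjoint_filter]
      intro i _ h1 h2
      exact hk'm.2 (by rw [← h2, h1])
    have := Finset.card_union_of_disjoint hdisj
    have h2 := Finset.card_le_univ ((Finset.univ.filter fun i => Int.gcd (p i) q =
      Int.gcd (p k) q) ∪ (Finset.univ.filter fun i => Int.gcd (p i) q = Int.gcd (p k') q))
    rw [Fintype.card_fin] at h2
    omega
  have h1 : ((Int.gcd (p k) q : ℕ) : ℤ) ∣ gcd (q : ℤ) (Finset.univ.gcd p) :=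
    dvd_gcd (Int.gcd_dvd_right ..) (Finset.dvd_gcd fun i _ =>
      (Int.natCast_dvd_natCast.mpr (hall i)).trans (Int.gcd_dvd_left ..))
  rw [hgcd] at h1
  have h1' : Int.gcd (p k) q = 1 := by exact_mod_cast Int.eq_one_of_dvd_one (by positivity) h1
  rwa [h1'] at hck

/-! ### The cosecant inequality for vanishing families -/

/-- Invertible frequencies `P i`, with inverses `b i`, no two of them equal up to sign, and shifts
`r i` such that the Fourier coefficients of the sum of sawtooth functions vanish at all `P k`. -/
structure VanishingFamily {q : ℕ} [NeZero q] {ι : Type*} [Fintype ι] (P r b : ι → ZMod q) :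
    Prop where
  mul_inv : ∀ i, P i * b i = 1
  ne : ∀ i k, i ≠ k → P i ≠ P k ∧ P i ≠ -P k
  sum_eq_zero : ∀ k, ∑ i, ZMod.stdAddChar (P k * (r i + b i)) /
    (ZMod.stdAddChar (P k * b i) - 1) = (0 : ℂ)

/-- The distance of a residue class to zero. -/
def absRes {q : ℕ} (a : ZMod q) : ℕ := a.valMinAbs.natAbs

/-- The ratio of cosecants `csc (π a / q) / csc (π / q)`. -/
noncomputable def cscRatio (q a : ℕ) : ℝ := Real.sin (Real.pi / q) / Real.sin (Real.pi * a / q)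

theorem sin_pi_mul_div_pos {q a : ℕ} (hq : 0 < q) (h0 : 0 < a) (ha : a ≤ q / 2) :
    0 < Real.sin (Real.pi * a / q) := by
  have := sin_pi_mul_div_lt hq h0 ha
  simpa using this

theorem sin_pi_div_pos {q : ℕ} (hq : 2 ≤ q) : 0 < Real.sin (Real.pi / q) := by
  have := sin_pi_mul_div_pos (q := q) (a := 1) (by omega) one_pos (by omega)
  simpa using this

theorem cscRatio_antitone {q a b : ℕ} (hq : 2 ≤ q) (h0 : 0 < a) (hab : a ≤ b) (hb : b ≤ q / 2) :
    cscRatio q b ≤ cscRatio q a := by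
  rcases hab.eq_or_lt with rfl | hlt
  · exact le_rfl
  · unfold cscRatio
    have h1 := sin_pi_div_pos hq
    have h2 := sin_pi_mul_div_pos (by omega) h0 (hab.trans hb)
    have h3 := sin_pi_mul_div_lt (by omega) hlt hb
    gcongr

theorem absRes_eq_iff {q : ℕ} [NeZero q] {a b : ZMod q} :
    absRes a = absRes b ↔ a = b ∨ a = -b := ZMod.natAbs_valMinAbs_eq_natAbs_valMinAbs

theorem absRes_le {q : ℕ} [NeZero q] (a : ZMod q) : absRes a ≤ q / 2 :=
  ZMod.natAbs_valMinAbs_le a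

theorem eq_or_eq_neg_absRes {q : ℕ} [NeZero q] (a : ZMod q) :
    a = (absRes a : ZMod q) ∨ a = -(absRes a : ZMod q) := by
  have h := ZMod.coe_valMinAbs a
  rcases Int.natAbs_eq a.valMinAbs with h' | h'
  · left
    rw [h'] at h
    rw [absRes]
    conv_lhs => rw [← h]
    exact Int.cast_natCast _
  · right
    rw [h'] at h
    rw [absRes]
    conv_lhs => rw [← h]
    rw [Int.cast_neg, Int.cast_natCast]

theorem coprime_absRes {q : ℕ} [NeZero q] {a b : ZMod q} (h : a * b = 1) :
    (absRes a).Coprime q := by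
  rw [← ZMod.isUnit_iff_coprime]
  rcases eq_or_eq_neg_absRes a with h' | h'
  · exact IsUnit.of_mul_eq_one b (h' ▸ h)
  · exact IsUnit.of_mul_eq_one (-b) (by rw [mul_neg, ← neg_mul, ← h', h])

theorem absRes_natCast {q a : ℕ} (ha : a ≤ q / 2) : absRes (a : ZMod q) = a := by
  rw [absRes, ZMod.valMinAbs_natCast_of_le_half ha, Int.natAbs_natCast]

theorem norm_stdAddChar_sub_one_inv_mul {q : ℕ} [NeZero q] (hq : 2 ≤ q) (a : ZMod q) :
    cscRatio q (absRes a) = 2 * Real.sin (Real.pi / q) * ‖(ZMod.stdAddChar a : ℂ) - 1‖⁻¹ := by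
  rw [norm_stdAddChar_sub_one, abs_of_nonneg (sin_pi_mul_div_nonneg (by omega)
    (ZMod.natAbs_valMinAbs_le a)), cscRatio, absRes]
  field_simp

namespace VanishingFamily

variable {q : ℕ} [NeZero q] {ι : Type*} {P r b : ι → ZMod q}

theorem norm_term (hq : 2 ≤ q) (k i : ι) :
    2 * Real.sin (Real.pi / q) * ‖(ZMod.stdAddChar (P k * (r i + b i)) : ℂ) /
      (ZMod.stdAddChar (P k * b i) - 1)‖ = cscRatio q (absRes (P k * b i)) := by
  rw [norm_div, AddChar.norm_apply, one_div, norm_stdAddChar_sub_one_inv_mul hq]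

variable [Fintype ι]

theorem cscRatio_self (h : VanishingFamily P r b) (hq : 2 ≤ q) (k : ι) :
    cscRatio q (absRes (P k * b k)) = 1 := by
  rw [h.mul_inv, ← Nat.cast_one, absRes_natCast (by omega), cscRatio, Nat.cast_one, mul_one,
    div_self (sin_pi_div_pos hq).ne']

variable [DecidableEq ι]

/-- The triangle inequality for the vanishing sum at `P k`, scaled so that the term of index `k` has
modulus 1. -/
theorem one_le_sum (h : VanishingFamily P r b) (hq : 2 ≤ q) (k : ι) :
    1 ≤ ∑ i ∈ Finset.univ.erase k, cscRatio q (absRes (P k * b i)) := by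
  have hs := h.sum_eq_zero k
  rw [← Finset.add_sum_erase _ _ (Finset.mem_univ k)] at hs
  have hn := congrArg norm (eq_neg_of_add_eq_zero_left hs)
  rw [norm_neg] at hn
  have hle := norm_sum_le (Finset.univ.erase k) (fun i => (ZMod.stdAddChar (P k * (r i + b i)) : ℂ) /
      (ZMod.stdAddChar (P k * b i) - 1))
  rw [← hn] at hle
  have h2 : 0 ≤ 2 * Real.sin (Real.pi / q) := by have := sin_pi_div_pos hq; linarith
  have := mul_le_mul_of_nonneg_left hle h2
  rw [Finset.mul_sum, norm_term hq, h.cscRatio_self hq] at this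
  simpa only [norm_term hq] using this

/-- When the triangle inequality is an equality, the terms are negative multiples of the
dominating one. -/
theorem exists_neg_ratio (h : VanishingFamily P r b) (hq : 2 ≤ q) (k : ι)
    (heq : ∑ i ∈ Finset.univ.erase k, cscRatio q (absRes (P k * b i)) = 1) (i : ι) (hik : i ≠ k) :
    ∃ ρ : ℝ, ρ ≤ 0 ∧ (ZMod.stdAddChar (P k * (r i + b i)) : ℂ) /
        (ZMod.stdAddChar (P k * b i) - 1) =
      ρ * ((ZMod.stdAddChar (P k * (r k + b k)) : ℂ) / (ZMod.stdAddChar (P k * b k) - 1)) := by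
  set z : ι → ℂ := fun i => (ZMod.stdAddChar (P k * (r i + b i)) : ℂ) /
        (ZMod.stdAddChar (P k * b i) - 1) with hz
  have hs : ∑ i, z i = 0 := h.sum_eq_zero k
  rw [← Finset.add_sum_erase _ _ (Finset.mem_univ k)] at hs
  have hs2 := sin_pi_div_pos hq
  have hnorm : ∀ i, 2 * Real.sin (Real.pi / q) * ‖z i‖ = cscRatio q (absRes (P k * b i)) :=
    fun i => norm_term hq k i
  have hnk : 2 * Real.sin (Real.pi / q) * ‖z k‖ = 1 := by rw [hnorm, h.cscRatio_self hq]
  have hsum : ∑ i ∈ Finset.univ.erase k, ‖z i‖ = ‖z k‖ := by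
    have : 2 * Real.sin (Real.pi / q) * ∑ i ∈ Finset.univ.erase k, ‖z i‖ =
        2 * Real.sin (Real.pi / q) * ‖z k‖ := by
      rw [Finset.mul_sum, hnk, ← heq]
      exact Finset.sum_congr rfl fun i _ => hnorm i
    exact mul_left_cancel₀ (by linarith) this
  have hzk : z k ≠ 0 := by
    intro h0
    rw [h0, norm_zero, mul_zero] at hnk
    exact zero_ne_one hnk
  -- Each summand is nonnegative and the total is zero, so every `z i / z k` has real part minus its
  -- modulus, which makes it real and nonpositive.
  have hre : ∑ i ∈ Finset.univ.erase k, (‖z i‖ / ‖z k‖ + (z i / z k).re) = 0 := by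
    rw [Finset.sum_add_distrib, ← Finset.sum_div, hsum, ← Complex.re_sum, ← Finset.sum_div,
      div_self (norm_ne_zero_iff.mpr hzk), eq_neg_of_add_eq_zero_right hs, neg_div, div_self hzk]
    simp
  have hnn : ∀ i ∈ Finset.univ.erase k, 0 ≤ ‖z i‖ / ‖z k‖ + (z i / z k).re := by
    intro i _
    have := Complex.abs_re_le_norm (z i / z k)
    rw [norm_div] at this
    linarith [neg_abs_le (z i / z k).re]
  have hi := (Finset.sum_eq_zero_iff_of_nonneg hnn).mp hre i (by simp [hik])
  have hre' : (z i / z k).re = -‖z i / z k‖ := by rw [norm_div]; linarith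
  have him : (z i / z k).im = 0 := by
    have h1 := Complex.sq_norm (z i / z k)
    rw [Complex.normSq_apply, hre'] at h1
    nlinarith
  refine ⟨(z i / z k).re, by rw [hre']; exact neg_nonpos.mpr (norm_nonneg _), ?_⟩
  have : (((z i / z k).re : ℝ) : ℂ) = z i / z k := by
    apply Complex.ext <;> simp [him]
  rw [this, div_mul_cancel₀ _ hzk]

/-- The residues `P k / P i` up to sign. -/
def ratios (P b : ι → ZMod q) (k : ι) : Finset ℕ :=
  (Finset.univ.erase k).image fun i => absRes (P k * b i)

theorem absRes_injective (h : VanishingFamily P r b) (k : ι) :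
    Function.Injective fun i => absRes (P k * b i) := by
  intro i j hij
  by_contra hne
  have h1 := h.mul_inv i
  have h2 := h.mul_inv j
  have h3 := h.mul_inv k
  rcases absRes_eq_iff.mp hij with e | e
  · exact (h.ne i j hne).1 (by
      linear_combination (-P i * P j * b k) * e + P j * P k * b k * h1 - P i * P k * b k * h2 -
        (P i - P j) * h3)
  · exact (h.ne i j hne).2 (by
      linear_combination (P i * P j * b k) * e - P j * P k * b k * h1 - P i * P k * b k * h2 -
        (P i + P j) * h3)

theorem card_ratios (h : VanishingFamily P r b) (k : ι) :
    (ratios P b k).card = Fintype.card ι - 1 := by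
  rw [ratios, Finset.card_image_of_injective _ (h.absRes_injective k),
    Finset.card_erase_of_mem (Finset.mem_univ k), Finset.card_univ]

theorem ratios_subset (h : VanishingFamily P r b) (hq : 2 ≤ q) (k : ι) :
    ratios P b k ⊆ (Finset.Icc 2 (q / 2)).filter fun a => a.Coprime q := by
  intro a ha
  obtain ⟨i, hi, rfl⟩ := Finset.mem_image.mp ha
  have hik := Finset.ne_of_mem_erase hi
  have hc : (absRes (P k * b i)).Coprime q := coprime_absRes (b := P i * b k) (by
    linear_combination P k * b k * h.mul_inv i + h.mul_inv k)
  rw [Finset.mem_filter, Finset.mem_Icc]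
  refine ⟨⟨?_, absRes_le _⟩, hc⟩
  by_contra hlt
  have h1 : absRes (P k * b i) ≠ 1 := by
    have := (h.absRes_injective k).ne hik
    simp only [h.mul_inv] at this
    rwa [← Nat.cast_one, absRes_natCast (by omega)] at this
  have h0 : absRes (P k * b i) ≠ 0 := by
    intro h0
    rw [h0, Nat.coprime_zero_left] at hc
    omega
  omega

theorem one_le_sum_ratios (h : VanishingFamily P r b) (hq : 2 ≤ q) (k : ι) :
    1 ≤ ∑ a ∈ ratios P b k, cscRatio q a := by
  rw [ratios, Finset.sum_image fun i _ j _ e => h.absRes_injective k e]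
  exact h.one_le_sum hq k

theorem eq_mul_of_mem_ratios (h : VanishingFamily P r b) {k : ι} {a : ℕ}
    (ha : a ∈ ratios P b k) : ∃ i, P k = a * P i ∨ P k = -(a * P i) := by
  obtain ⟨i, -, rfl⟩ := Finset.mem_image.mp ha
  refine ⟨i, ?_⟩
  rcases eq_or_eq_neg_absRes (P k * b i) with e | e
  · left
    linear_combination P i * e - P k * h.mul_inv i
  · right
    linear_combination P i * e - P k * h.mul_inv i

end VanishingFamily

/-! ### Numerical bounds for cosecant ratios -/

/-- A sum of an antitone function over a finite set of integers `≥ l` is at most its sum over the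
first integers `≥ l`. -/
theorem sum_le_sum_range_of_antitone {f : ℕ → ℝ} {l M : ℕ}
    (hf : ∀ a b, l ≤ a → a ≤ b → b ≤ M → f b ≤ f a) (n : ℕ) (R : Finset ℕ) (hn : R.card = n)
    (hR : R ⊆ Finset.Icc l M) : ∑ a ∈ R, f a ≤ ∑ i ∈ Finset.range n, f (l + i) := by
  induction n generalizing R with
  | zero => simp [Finset.card_eq_zero.mp hn]
  | succ n ih =>
    have hne : R.Nonempty := Finset.card_pos.mp (by omega)
    have hmem := R.max'_mem hne
    have hle : l + n ≤ R.max' hne := by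
      have hsub : R ⊆ Finset.Icc l (R.max' hne) := fun a ha =>
        Finset.mem_Icc.mpr ⟨(Finset.mem_Icc.mp (hR ha)).1, R.le_max' a ha⟩
      have := Finset.card_le_card hsub
      rw [Nat.card_Icc] at this
      have := (Finset.mem_Icc.mp (hR hmem)).1
      omega
    rw [← Finset.add_sum_erase _ _ hmem, Finset.sum_range_succ, add_comm]
    exact add_le_add (ih _ (by rw [Finset.card_erase_of_mem hmem]; omega)
      ((Finset.erase_subset _ _).trans hR))
      (hf _ _ (by omega) hle (Finset.mem_Icc.mp (hR hmem)).2)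

theorem cos_pi_div_ge {q : ℕ} {Q : ℝ} (hQ : 0 < Q) (hq : Q ≤ q) :
    1 - (3.1416 / Q) ^ 2 / 2 ≤ Real.cos (Real.pi / q) := by
  have h1 := Real.one_sub_sq_div_two_le_cos (x := Real.pi / q)
  have h2 : Real.pi / q ≤ 3.1416 / Q := by
    have := Real.pi_lt_d4
    have := Real.pi_pos
    gcongr
  have h3 : 0 ≤ Real.pi / q := by have := Real.pi_pos; positivity
  have h4 : (Real.pi / q) ^ 2 ≤ (3.1416 / Q) ^ 2 := pow_le_pow_left₀ h3 h2 2
  linarith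

/-- An upper bound for a ratio of cosecants from a lower bound for the ratio of sines. -/
theorem cscRatio_le {q a : ℕ} {t : ℝ} (hq : 2 ≤ q) (ht : 0 < t)
    (h : t * Real.sin (Real.pi / q) ≤ Real.sin (Real.pi * a / q)) : cscRatio q a ≤ 1 / t := by
  have hs := sin_pi_div_pos hq
  rw [cscRatio, div_le_div_iff₀ (lt_of_lt_of_le (mul_pos ht hs) h) ht]
  linarith

theorem sin_mul_eq (x : ℝ) :
    Real.sin (2 * x) = (2 * Real.cos x) * Real.sin x ∧
    Real.sin (3 * x) = (4 * Real.cos x ^ 2 - 1) * Real.sin x ∧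
    Real.sin (4 * x) = (8 * Real.cos x ^ 3 - 4 * Real.cos x) * Real.sin x ∧
    Real.sin (5 * x) = (16 * Real.cos x ^ 4 - 12 * Real.cos x ^ 2 + 1) * Real.sin x ∧
    Real.sin (6 * x) =
      (32 * Real.cos x ^ 5 - 32 * Real.cos x ^ 3 + 6 * Real.cos x) * Real.sin x ∧
    Real.sin (7 * x) =
      (64 * Real.cos x ^ 6 - 80 * Real.cos x ^ 4 + 24 * Real.cos x ^ 2 - 1) * Real.sin x := by
  have h2 := Real.sin_two_mul x
  have c2 := Real.cos_two_mul x
  have h3 : Real.sin (3 * x) = (4 * Real.cos x ^ 2 - 1) * Real.sin x := by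
    rw [Real.sin_three_mul]
    linear_combination (-4 * Real.sin x) * Real.sin_sq_add_cos_sq x
  have c3 := Real.cos_three_mul x
  have h4 : Real.sin (4 * x) = (8 * Real.cos x ^ 3 - 4 * Real.cos x) * Real.sin x := by
    rw [show 4 * x = 2 * (2 * x) by ring, Real.sin_two_mul, h2, c2]; ring
  have c4 : Real.cos (4 * x) = 8 * Real.cos x ^ 4 - 8 * Real.cos x ^ 2 + 1 := by
    rw [show 4 * x = 2 * (2 * x) by ring, Real.cos_two_mul, c2]; ring
  refine ⟨by rw [h2]; ring, h3, h4, ?_, ?_, ?_⟩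
  · rw [show 5 * x = 3 * x + 2 * x by ring, Real.sin_add, h3, c3, h2, c2]; ring
  · rw [show 6 * x = 2 * (3 * x) by ring, Real.sin_two_mul, h3, c3]; ring
  · rw [show 7 * x = 4 * x + 3 * x by ring, Real.sin_add, h3, c3, h4, c4]; ring

/-- The quotient `sin(a π / q) / sin(π / q)` is a polynomial in `cos(π / q)` that increases on the
range considered, so a lower bound for the cosine suffices. -/
theorem cscRatio_bounds {q : ℕ} {c : ℝ} (hq : 2 ≤ q) (hc : 0.92 ≤ c)
    (hcos : c ≤ Real.cos (Real.pi / q)) :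
    cscRatio q 2 ≤ 1 / (2 * c) ∧ cscRatio q 3 ≤ 1 / (4 * c ^ 2 - 1) ∧
    cscRatio q 4 ≤ 1 / (8 * c ^ 3 - 4 * c) ∧
    cscRatio q 5 ≤ 1 / (16 * c ^ 4 - 12 * c ^ 2 + 1) ∧
    (0.98 ≤ c → cscRatio q 6 ≤ 1 / (32 * c ^ 5 - 32 * c ^ 3 + 6 * c) ∧
      cscRatio q 7 ≤ 1 / (64 * c ^ 6 - 80 * c ^ 4 + 24 * c ^ 2 - 1)) := by
  set x := Real.pi / q with hx
  set C := Real.cos x with hC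
  obtain ⟨h2, h3, h4, h5, h6, h7⟩ := sin_mul_eq x
  have hs : 0 < Real.sin x := sin_pi_div_pos hq
  have e : ∀ a : ℕ, Real.pi * a / q = a * x := fun a => by rw [hx]; ring
  have hy : c ^ 2 ≤ C ^ 2 := pow_le_pow_left₀ (by linarith) hcos 2
  have hy0 : 0.8464 ≤ c ^ 2 := by nlinarith
  have sq4 : ∀ u : ℝ, u ^ 4 = (u ^ 2) ^ 2 := fun u => by ring
  have sq6 : ∀ u : ℝ, u ^ 6 = (u ^ 2) ^ 3 := fun u => by ring
  refine ⟨?_, ?_, ?_, ?_, fun hc' => ⟨?_, ?_⟩⟩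
  · refine cscRatio_le hq (by linarith) ?_
    rw [e]; push_cast; rw [h2]
    gcongr
  · refine cscRatio_le hq (by linarith) ?_
    rw [e]; push_cast; rw [h3]
    gcongr
  · have hf : ∀ u : ℝ, 8 * u ^ 3 - 4 * u = (4 * u) * (2 * u ^ 2 - 1) := fun u => by ring
    refine cscRatio_le hq ?_ ?_
    · rw [hf]; exact mul_pos (by linarith) (by linarith)
    rw [e]; push_cast; rw [h4, ← hx, hf, hf]
    have : 0 ≤ 2 * c ^ 2 - 1 := by linarith
    have : 0 ≤ 4 * Real.cos x := by rw [← hC]; linarith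
    gcongr
  · refine cscRatio_le hq ?_ ?_
    · rw [sq4]; nlinarith
    rw [e]; push_cast; rw [h5, ← hx]
    refine mul_le_mul_of_nonneg_right ?_ hs.le
    rw [← hC, sq4 C, sq4 c]
    nlinarith
  · have hy1 : 0.96 ≤ c ^ 2 := by nlinarith
    have hf : ∀ u : ℝ, 32 * u ^ 5 - 32 * u ^ 3 + 6 * u =
      (2 * u) * (16 * (u ^ 2) ^ 2 - 16 * u ^ 2 + 3) := fun u => by ring
    have hpos : 0 < 16 * (c ^ 2) ^ 2 - 16 * c ^ 2 + 3 := by nlinarith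
    refine cscRatio_le hq ?_ ?_
    · rw [hf]; exact mul_pos (by linarith) hpos
    rw [e]; push_cast; rw [h6, ← hx, hf, hf]
    have hm : 16 * (c ^ 2) ^ 2 - 16 * c ^ 2 + 3 ≤ 16 * (C ^ 2) ^ 2 - 16 * C ^ 2 + 3 := by nlinarith
    refine mul_le_mul_of_nonneg_right ?_ hs.le
    exact mul_le_mul (by linarith) hm hpos.le (by linarith)
  · have hy1 : 0.96 ≤ c ^ 2 := by nlinarith
    have hmono : ∀ u v : ℝ, 0.96 ≤ u → u ≤ v →
        64 * u ^ 3 - 80 * u ^ 2 + 24 * u - 1 ≤ 64 * v ^ 3 - 80 * v ^ 2 + 24 * v - 1 := by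
      intro u v hu huv
      have h1 : 0 ≤ (v - u) * (64 * (v ^ 2 + v * u + u ^ 2) - 80 * (v + u) + 24) := by
        refine mul_nonneg (by linarith) ?_
        nlinarith [mul_nonneg (sub_nonneg.mpr hu) (sub_nonneg.mpr (hu.trans huv)),
          mul_nonneg (sub_nonneg.mpr hu) (sub_nonneg.mpr hu),
          mul_nonneg (sub_nonneg.mpr (hu.trans huv)) (sub_nonneg.mpr (hu.trans huv))]
      nlinarith
    refine cscRatio_le hq ?_ ?_
    · rw [sq4, sq6]
      have := hmono 0.96 (c ^ 2) le_rfl hy1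
      norm_num at this ⊢
      linarith
    rw [e]; push_cast; rw [h7, ← hx]
    refine mul_le_mul_of_nonneg_right ?_ hs.le
    rw [← hC, sq4 C, sq4 c, sq6 C, sq6 c]
    exact hmono _ _ hy1 hy

/-- The limit is `1/2 + 1/3`. The constant 0.92 is a lower bound for `cos(π / 8)`; the next three
lemmas use their cosine bounds in the same way. -/
theorem cscRatio_two_three {q : ℕ} (hq : 8 ≤ q) : cscRatio q 2 + cscRatio q 3 < 1 := by
  have hc := cos_pi_div_ge (q := q) (Q := 8) (by norm_num) (by exact_mod_cast hq)
  obtain ⟨h2, h3, -⟩ := cscRatio_bounds (q := q) (c := 0.92) (by omega) le_rfl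
    (le_trans (by norm_num) hc)
  norm_num at h2 h3
  linarith

theorem cscRatio_three_four_five {q : ℕ} (hq : 11 ≤ q) :
    cscRatio q 3 + cscRatio q 4 + cscRatio q 5 < 1 := by
  have hc := cos_pi_div_ge (q := q) (Q := 11) (by norm_num) (by exact_mod_cast hq)
  obtain ⟨-, h3, h4, h5, -⟩ := cscRatio_bounds (q := q) (c := 0.959) (by omega) (by norm_num)
    (le_trans (by norm_num) hc)
  norm_num at h3 h4 h5
  linarith

/-- This sum dominates that of any four integers from 3 to `q / 2` that do not contain both 3 and 4.
-/
theorem cscRatio_three_five_six_seven {q : ℕ} (hq : 17 ≤ q) :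
    cscRatio q 3 + cscRatio q 5 + cscRatio q 6 + cscRatio q 7 < 1 := by
  have hc := cos_pi_div_ge (q := q) (Q := 17) (by norm_num) (by exact_mod_cast hq)
  obtain ⟨-, h3, -, h5, h67⟩ := cscRatio_bounds (q := q) (c := 0.9825) (by omega) (by norm_num)
    (le_trans (by norm_num) hc)
  obtain ⟨h6, h7⟩ := h67 (by norm_num)
  norm_num at h3 h5 h6 h7
  linarith

/-- The limit is `19/20`, so close to 1 that `q` must be fairly large; smaller `q` are left to
`not_doubling_five_classes`. -/
theorem cscRatio_three_four_five_six {q : ℕ} (hq : 25 ≤ q) :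
    cscRatio q 3 + cscRatio q 4 + cscRatio q 5 + cscRatio q 6 < 1 := by
  have hc := cos_pi_div_ge (q := q) (Q := 25) (by norm_num) (by exact_mod_cast hq)
  obtain ⟨-, h3, h4, h5, h67⟩ := cscRatio_bounds (q := q) (c := 0.9921) (by omega) (by norm_num)
    (le_trans (by norm_num) hc)
  obtain ⟨h6, -⟩ := h67 (by norm_num)
  norm_num at h3 h4 h5 h6
  linarith

theorem not_doubling_five_classes : ∀ q ∈ Finset.Icc 17 24,
    ∀ S ∈ ((Finset.Icc 1 (q / 2)).filter fun a => a.Coprime q).powersetCard 5,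
      ¬ ∀ s ∈ S, (∃ t ∈ S, (2 * t) % q = s ∨ (2 * t + s) % q = 0) ∨
        ((∃ t ∈ S, (3 * t) % q = s ∨ (3 * t + s) % q = 0) ∧
          ∃ t ∈ S, (4 * t) % q = s ∨ (4 * t + s) % q = 0) := by
  decide +kernel

/-! ### Cosecant sums along powers of two -/

/-- Telescoping sum of cosecants along a geometric progression of ratio two. -/
theorem sum_csc_two_pow (y : ℝ) (n : ℕ) (h : ∀ t ≤ n, Real.sin (2 ^ t * y) ≠ 0) :
    ∑ t ∈ Finset.range n, 1 / Real.sin (2 ^ (t + 1) * y) =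
      Real.cos y / Real.sin y - Real.cos (2 ^ n * y) / Real.sin (2 ^ n * y) := by
  induction n with
  | zero => simp
  | succ n ih =>
    rw [Finset.sum_range_succ, ih fun t ht => h t (by omega)]
    have h1 := h n (by omega)
    have h2 := h (n + 1) le_rfl
    have e : (2 : ℝ) ^ (n + 1) * y = 2 * (2 ^ n * y) := by ring
    rw [e] at h2 ⊢
    generalize 2 ^ n * y = z at *
    rw [Real.sin_two_mul] at h2
    have h3 : Real.cos z ≠ 0 := fun h0 => h2 (by rw [h0, mul_zero])
    -- The telescoping identity is `csc 2z = cot z - cot 2z`.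
    rw [Real.sin_two_mul, Real.cos_two_mul]
    field_simp
    ring

theorem cscRatio_absRes_natCast {q a : ℕ} (ha : a < q) :
    cscRatio q (absRes (a : ZMod q)) = Real.sin (Real.pi / q) / Real.sin (Real.pi * a / q) := by
  have : NeZero q := ⟨by omega⟩
  rcases le_or_gt a (q / 2) with h | h
  · rw [absRes_natCast h, cscRatio]
  · have e : absRes (a : ZMod q) = q - a := by
      have h1 : (a : ZMod q) = -((q - a : ℕ) : ZMod q) := by
        rw [Nat.cast_sub ha.le]; simp
      have h2 : absRes (a : ZMod q) = absRes ((q - a : ℕ) : ZMod q) :=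
        absRes_eq_iff.mpr (Or.inr h1)
      rw [h2, absRes_natCast (by omega)]
    have hq : (q : ℝ) ≠ 0 := by exact_mod_cast NeZero.ne q
    rw [e, cscRatio, Nat.cast_sub ha.le, ← Real.sin_pi_sub (Real.pi * a / q)]
    congr 2
    field_simp

/-- The sum of the cosecant ratios at the powers of two, for `q = 2 ^ n - 1` and
`q = 2 ^ n + 1`. -/
theorem sum_cscRatio_two_pow {q n : ℕ} (hn : 2 ≤ n) (hq : q + 1 = 2 ^ n ∨ q = 2 ^ n + 1) :
    (q + 1 = 2 ^ n →
      ∑ t ∈ Finset.range n, cscRatio q (absRes ((2 : ZMod q) ^ t)) = 2) ∧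
    (q = 2 ^ n + 1 →
      ∑ t ∈ Finset.range n, cscRatio q (absRes ((2 : ZMod q) ^ t)) < 2) := by
  have h4 : 4 ≤ 2 ^ n := by
    calc 4 = 2 ^ 2 := rfl
      _ ≤ 2 ^ n := Nat.pow_le_pow_right two_pos hn
  have hq3 : 3 ≤ q := by omega
  have hqR : (0 : ℝ) < q := by exact_mod_cast (by omega : 0 < q)
  have hpi := Real.pi_pos
  set y := Real.pi / (2 * q) with hy
  have hy0 : 0 < y := by positivity
  have hqy : q * y = Real.pi / 2 := by rw [hy]; field_simp
  have hlt : ∀ t < n, 2 ^ t < q := by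
    intro t ht
    have : 2 ^ (t + 1) ≤ 2 ^ n := Nat.pow_le_pow_right two_pos ht
    rw [pow_succ] at this
    omega
  have hterm : ∀ t ∈ Finset.range n, cscRatio q (absRes ((2 : ZMod q) ^ t)) =
      Real.sin (2 * y) * (1 / Real.sin (2 ^ (t + 1) * y)) := by
    intro t ht
    have := cscRatio_absRes_natCast (hlt t (Finset.mem_range.mp ht))
    push_cast at this
    rw [this, mul_one_div]
    congr 2
    · rw [hy]; field_simp
    · rw [hy]; field_simp; ring
  have hy2 : 2 * y < Real.pi / 2 := by
    rw [← hqy]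
    have : (2 : ℝ) < q := by exact_mod_cast hq3
    nlinarith
  have hsin : ∀ t ≤ n, Real.sin (2 ^ t * y) ≠ 0 := by
    intro t ht
    refine (Real.sin_pos_of_pos_of_lt_pi (by positivity) ?_).ne'
    have h1 : (2 : ℝ) ^ t ≤ 2 ^ n := pow_le_pow_right₀ one_le_two ht
    have h2 : (2 : ℝ) ^ n ≤ q + 1 := by
      have : 2 ^ n ≤ q + 1 := by omega
      exact_mod_cast this
    have h3 : (2 : ℝ) ^ t * y ≤ (q + 1) * y := mul_le_mul_of_nonneg_right (h1.trans h2) hy0.le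
    nlinarith
  rw [Finset.sum_congr rfl hterm, ← Finset.mul_sum, sum_csc_two_pow y n hsin]
  have hs : 0 < Real.sin y := Real.sin_pos_of_pos_of_lt_pi hy0 (by linarith)
  have hc : 0 < Real.cos y := Real.cos_pos_of_mem_Ioo ⟨by linarith, by linarith⟩
  have hcs := Real.sin_sq_add_cos_sq y
  constructor
  · intro h
    have h' : (2 : ℝ) ^ n = q + 1 := by exact_mod_cast h.symm
    -- Since `q y = π / 2`, the last cotangent becomes `-tan y`, and `sin 2y (cot y + tan y) = 2`.
    -- In the other case it is `tan y`, and the value is `2 cos 2y < 2`.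
    have e : 2 ^ n * y = y + Real.pi / 2 := by rw [h', ← hqy]; ring
    rw [e, Real.cos_add_pi_div_two, Real.sin_add_pi_div_two, Real.sin_two_mul]
    field_simp
    linear_combination hcs
  · intro h
    have h' : (2 : ℝ) ^ n = q - 1 := by
      have : (q : ℝ) = 2 ^ n + 1 := by exact_mod_cast h
      linarith
    have e : 2 ^ n * y = Real.pi / 2 - y := by rw [h', ← hqy]; ring
    rw [e, Real.cos_pi_div_two_sub, Real.sin_pi_div_two_sub, Real.sin_two_mul]
    have e2 : 2 * Real.sin y * Real.cos y *
        (Real.cos y / Real.sin y - Real.sin y / Real.cos y) =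
        2 * (Real.cos y ^ 2 - Real.sin y ^ 2) := by field_simp
    rw [e2]
    nlinarith

/-! ### Phases in the case of equality -/

open ZMod in
/-- A negative real ratio of two terms determines their relative phase. -/
theorem phase_of_neg_ratio {q h : ℕ} [NeZero q] (hq : 3 ≤ q) (hh : 2 * h = q + 1) {D a : ZMod q}
    {ρ : ℝ} (hρ : ρ ≤ 0) (ha : a = 2 ∨ a = -2)
    (heq : (stdAddChar D : ℂ) * stdAddChar a / (stdAddChar a - 1) =
      ρ * (stdAddChar (1 : ZMod q) / (stdAddChar (1 : ZMod q) - 1))) :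
    a = 2 ∧ D = -h := by
  set η : ℂ := stdAddChar (h : ZMod q) with hη
  have h2h : (2 : ZMod q) * h = 1 := by
    have : ((2 * h : ℕ) : ZMod q) = ((q + 1 : ℕ) : ZMod q) := by rw [hh]
    push_cast at this
    simpa using this
  have hη2 : η ^ 2 = stdAddChar (1 : ZMod q) := by
    rw [hη, ← AddChar.map_nsmul_eq_pow, nsmul_eq_mul]
    push_cast; rw [h2h]
  have hη4 : η ^ 4 = stdAddChar (2 : ZMod q) := by
    rw [show η ^ 4 = (η ^ 2) ^ 2 by ring, hη2, ← AddChar.map_nsmul_eq_pow]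
    simp
  have hη0 : η ≠ 0 := by
    rw [hη, ← norm_ne_zero_iff, AddChar.norm_apply]
    exact one_ne_zero
  have hne4 : η ^ 4 - 1 ≠ 0 := by
    rw [hη4, sub_ne_zero, ← (stdAddChar (N := q)).map_zero_eq_one]
    intro h0
    have h1 := injective_stdAddChar h0
    have h2 : ((2 : ℕ) : ZMod q) = 0 := by exact_mod_cast h1
    rw [ZMod.natCast_eq_zero_iff] at h2
    exact absurd (Nat.le_of_dvd two_pos h2) (by omega)
  have hne2 : η ^ 2 - 1 ≠ 0 := fun h0 => hne4 (by
    rw [show η ^ 4 - 1 = (η ^ 2 - 1) * (η ^ 2 + 1) by ring, h0, zero_mul])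
  have hqR : (0 : ℝ) < q := by exact_mod_cast (by omega : 0 < q)
  -- The square root `η` of `e(1)` is `-exp(π i / q)`.
  have hre : η.re ≤ 0 := by
    have hc : (h : ZMod q) = ((h : ℤ) : ZMod q) := by simp
    rw [hη, hc, stdAddChar_coe]
    have e : (2 * Real.pi * Complex.I * (h : ℤ) / q : ℂ) =
        ((Real.pi / q + Real.pi : ℝ) : ℂ) * Complex.I := by
      have hhC : (2 * h : ℂ) = q + 1 := by exact_mod_cast hh
      have hqC : (q : ℂ) ≠ 0 := by exact_mod_cast NeZero.ne q
      push_cast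
      field_simp
      linear_combination hhC
    rw [e, Complex.exp_ofReal_mul_I_re, Real.cos_add_pi]
    have : 0 ≤ Real.cos (Real.pi / q) := by
      refine Real.cos_nonneg_of_mem_Icc ⟨?_, ?_⟩
      · have := Real.pi_pos
        have : 0 ≤ Real.pi / q := by positivity
        linarith
      · have : (2 : ℝ) ≤ q := by exact_mod_cast (by omega : 2 ≤ q)
        have := Real.pi_pos
        gcongr
    linarith
  have hconj : η + η⁻¹ = ((2 * η.re : ℝ) : ℂ) := by
    have : η⁻¹ = (starRingEnd ℂ) η := by
      rw [Complex.inv_def, Complex.normSq_eq_norm_sq, hη, AddChar.norm_apply]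
      simp
    rw [this, Complex.add_conj]
  have real_unit : ∀ (u : ZMod q) (t : ℝ), (stdAddChar u : ℂ) = t → t = 1 ∨ t = -1 := by
    intro u t hu
    have h1 : ‖(stdAddChar u : ℂ)‖ = 1 := AddChar.norm_apply _ _
    rw [hu, Complex.norm_real, Real.norm_eq_abs] at h1
    exact (abs_eq zero_le_one).mp h1
  rcases ha with rfl | rfl
  · refine ⟨rfl, ?_⟩
    rw [← hη4, ← hη2] at heq
    -- The equation reduces to `e(D) η = ρ (η + η⁻¹)`, a real number that is nonnegative because `ρ`
    -- and `η.re` are both nonpositive; having modulus 1, it equals 1.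
    have hk : (stdAddChar (D + (h : ZMod q)) : ℂ) = ((ρ * (2 * η.re) : ℝ) : ℂ) := by
      rw [AddChar.map_add_eq_mul, ← hη, Complex.ofReal_mul, ← hconj]
      rw [← mul_div_assoc, div_eq_div_iff hne4 hne2] at heq
      have h1 : η ^ 2 * (η ^ 2 - 1) * ((stdAddChar D : ℂ) * η * η - ρ * (η ^ 2 + 1)) = 0 := by
        linear_combination heq
      have h2 := (mul_eq_zero.mp h1).resolve_left (mul_ne_zero (pow_ne_zero 2 hη0) hne2)
      field_simp
      linear_combination h2
    rcases real_unit _ _ hk with h1 | h1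
    · rw [h1, Complex.ofReal_one, ← (stdAddChar (N := q)).map_zero_eq_one] at hk
      exact eq_neg_of_add_eq_zero_left (injective_stdAddChar hk)
    · nlinarith
  -- For `a = -2` the same reduction makes `e(D - 3 h)` real and nonpositive, hence `-1`, which is
  -- not a `q`-th root of unity for odd `q`.
  · exfalso
    rw [AddChar.map_neg_eq_inv, ← hη4, ← hη2] at heq
    have hk : (stdAddChar (D - 3 * (h : ZMod q)) : ℂ) = ((-(ρ * (2 * η.re)) : ℝ) : ℂ) := by
      have h3 : (stdAddChar (3 * (h : ZMod q)) : ℂ) = η ^ 3 := by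
        rw [hη, ← AddChar.map_nsmul_eq_pow, nsmul_eq_mul]
        push_cast; rfl
      rw [AddChar.map_sub_eq_div, h3, Complex.ofReal_neg, Complex.ofReal_mul, ← hconj]
      have hinv : (η ^ 4)⁻¹ - 1 ≠ 0 := by
        rw [sub_ne_zero, Ne, inv_eq_one]
        exact sub_ne_zero.mp hne4
      rw [← mul_div_assoc, div_eq_div_iff hinv hne2] at heq
      have hi4 : (η ^ 4)⁻¹ * η ^ 4 = 1 := inv_mul_cancel₀ (pow_ne_zero 4 hη0)
      have h1 : (η ^ 2 - 1) * ((stdAddChar D : ℂ) + ρ * η ^ 2 * (η ^ 2 + 1)) = 0 := by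
        linear_combination η ^ 4 * heq - ((stdAddChar D : ℂ) * (η ^ 2 - 1) - ρ * η ^ 2) * hi4
      have h2 := (mul_eq_zero.mp h1).resolve_left hne2
      field_simp
      linear_combination h2
    rcases real_unit _ _ hk with h1 | h1
    · nlinarith
    · rw [h1] at hk
      have hpow : (stdAddChar (D - 3 * (h : ZMod q)) : ℂ) ^ q = 1 := by
        rw [← AddChar.map_nsmul_eq_pow]
        simp
      have hodd : Odd q := ⟨h - 1, by omega⟩
      rw [hk, Complex.ofReal_neg, Complex.ofReal_one, hodd.neg_one_pow] at hpow
      norm_num at hpow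

/-! ### Halving of frequencies and the possible moduli -/

theorem absRes_of_eq_mul {q : ℕ} [NeZero q] {x y : ZMod q} {a : ℕ}
    (he : x = a * y ∨ x = -(a * y)) (hq : 2 ≤ q) :
    (a * absRes y) % q = absRes x ∨ (a * absRes y + absRes x) % q = 0 := by
  have hk := absRes_le x
  have key : ((a * absRes y : ℕ) : ZMod q) = (absRes x : ℕ) ∨
      ((a * absRes y + absRes x : ℕ) : ZMod q) = 0 := by
    push_cast
    rcases eq_or_eq_neg_absRes y with h1 | h1 <;>
    rcases eq_or_eq_neg_absRes x with h2 | h2 <;>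
    rcases he with h3 | h3 <;>
    generalize hA : (absRes y : ZMod q) = A at * <;>
    generalize hB : (absRes x : ZMod q) = B at * <;>
    rw [h1, h2] at h3 <;>
    first
    | (left; linear_combination h3)
    | (left; linear_combination -h3)
    | (right; linear_combination h3)
    | (right; linear_combination -h3)
  rcases key with h1 | h1
  · left
    rw [ZMod.natCast_eq_natCast_iff', Nat.mod_eq_of_lt (by omega : absRes x < q)] at h1
    exact h1
  · right
    rw [ZMod.natCast_eq_zero_iff] at h1
    exact Nat.mod_eq_zero_of_dvd h1

theorem iterate_halving {q : ℕ} {ι : Type*} {P : ι → ZMod q} {π : ι → ι}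
    (hP : ∀ k, P k = 2 * P (π k) ∨ P k = -(2 * P (π k))) (k : ι) (t : ℕ) : P k = 2 ^ t * P (π^[t] k) ∨ P k = -(2 ^ t * P (π^[t] k)) := by
  induction t with
  | zero => simp
  | succ t ih =>
    rw [Function.iterate_succ_apply']
    rcases ih with h1 | h1 <;> rcases hP (π^[t] k) with h2 | h2 <;> rw [h2] at h1
    · left; rw [h1]; ring
    · right; rw [h1]; ring
    · right; rw [h1]; ring
    · left; rw [h1]; ring

namespace VanishingFamily

variable {q : ℕ} [NeZero q] {ι : Type*} [Fintype ι] {P r b : ι → ZMod q}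

/-- Multiplying the relations over all `k` and cancelling the invertible product of the `P k`, which
`π` permutes. -/
theorem two_pow_card (h : VanishingFamily P r b) {π : ι → ι} (hπ : Function.Injective π)
    (hP : ∀ k, P k = 2 * P (π k) ∨ P k = -(2 * P (π k))) :
    (2 : ZMod q) ^ Fintype.card ι = 1 ∨ (2 : ZMod q) ^ Fintype.card ι = -1 := by
  have hex : ∀ k, ∃ e : ZMod q, (e = 1 ∨ e = -1) ∧ P k = e * (2 * P (π k)) := by
    intro k
    rcases hP k with h1 | h1
    · exact ⟨1, Or.inl rfl, by rw [one_mul]; exact h1⟩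
    · exact ⟨-1, Or.inr rfl, by rw [neg_one_mul]; exact h1⟩
  choose e he hPe using hex
  have hprod : ∏ k, P k = (∏ k, e k) * (2 ^ Fintype.card ι * ∏ k, P k) := by
    have hb : ∏ k, P (π k) = ∏ k, P k :=
      (Finite.injective_iff_bijective.mp hπ).prod_comp P
    conv_lhs => rw [Finset.prod_congr rfl fun k _ => hPe k]
    rw [Finset.prod_mul_distrib, Finset.prod_mul_distrib, hb, Finset.prod_const, Finset.card_univ]
  have hunit : (∏ k, P k) * ∏ k, b k = 1 := by
    rw [← Finset.prod_mul_distrib]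
    exact Finset.prod_eq_one fun k _ => h.mul_inv k
  have h1 : (∏ k, e k) * 2 ^ Fintype.card ι = 1 := by
    linear_combination (∏ k, b k) * hprod * (-1) +
      (1 - (∏ k, e k) * 2 ^ Fintype.card ι) * hunit
  have he' : (∏ k, e k) = 1 ∨ (∏ k, e k) = -1 := by
    refine Finset.prod_induction e (fun x => x = 1 ∨ x = -1) ?_ (Or.inl rfl) fun k _ => he k
    rintro x y (rfl | rfl) (rfl | rfl) <;> simp
  rcases he' with h3 | h3
  · left; rw [h3, one_mul] at h1; exact h1
  · right; rw [h3] at h1; linear_combination -h1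

variable [DecidableEq ι]

theorem one_le_sum_range (h : VanishingFamily P r b) (hq : 2 ≤ q) (k : ι) {l n : ℕ} (hl : 0 < l)
    (hn : Fintype.card ι = n + 1) (hR : ∀ a ∈ ratios P b k, l ≤ a) :
    1 ≤ ∑ i ∈ Finset.range n, cscRatio q (l + i) := by
  refine (h.one_le_sum_ratios hq k).trans (sum_le_sum_range_of_antitone (M := q / 2)
    (fun a b ha hab hb => cscRatio_antitone hq (by omega) hab hb) n _
    (by rw [h.card_ratios]; omega) fun a ha => Finset.mem_Icc.mpr ⟨hR a ha, ?_⟩)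
  exact (Finset.mem_Icc.mp (Finset.mem_filter.mp (h.ratios_subset hq k ha)).1).2

theorem card_le (h : VanishingFamily P r b) (hq : 2 ≤ q) (k : ι) :
    Fintype.card ι - 1 ≤ ((Finset.Icc 2 (q / 2)).filter fun a => a.Coprime q).card := by
  rw [← h.card_ratios k]
  exact Finset.card_le_card (h.ratios_subset hq k)

theorem two_le_of_mem_ratios (h : VanishingFamily P r b) (hq : 2 ≤ q) {k : ι} {a : ℕ}
    (ha : a ∈ ratios P b k) : 2 ≤ a ∧ a ≤ q / 2 :=
  Finset.mem_Icc.mp (Finset.mem_filter.mp (h.ratios_subset hq k ha)).1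

theorem eq_seven_of_card_three (h : VanishingFamily P r b) (hq : 2 ≤ q)
    (hc : Fintype.card ι = 3) : q = 7 ∧ ∀ k, 2 ∈ ratios P b k := by
  have k : ι := (Fintype.card_pos_iff.mp (by omega)).some
  have hlt : q < 8 := by
    by_contra h8
    have h1 := h.one_le_sum_range hq k (l := 2) (n := 2) two_pos hc
      fun a ha => (h.two_le_of_mem_ratios hq ha).1
    have h2 := cscRatio_two_three (q := q) (by omega)
    simp only [Finset.sum_range_succ, Finset.sum_range_zero] at h1
    norm_num at h1
    linarith
  have hcard := h.card_le hq k
  rw [hc] at hcard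
  have h7 : q = 7 := by
    clear h
    interval_cases q <;> first | rfl | exact absurd hcard (by decide)
  refine ⟨h7, fun k => ?_⟩
  by_contra h2
  have hsub : ratios P b k ⊆ {3} := fun a ha => by
    have h3 := h.two_le_of_mem_ratios hq ha
    have h4 : a ≠ 2 := fun h' => h2 (h' ▸ ha)
    rw [h7] at h3
    rw [Finset.mem_singleton]
    omega
  have := Finset.card_le_card hsub
  rw [h.card_ratios, hc, Finset.card_singleton] at this
  omega

theorem two_mem_of_card_four (h : VanishingFamily P r b) (hq : 2 ≤ q)
    (hc : Fintype.card ι = 4) : 11 ≤ q ∧ ∀ k, 2 ∈ ratios P b k := by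
  have k : ι := (Fintype.card_pos_iff.mp (by omega)).some
  have hcard := h.card_le hq k
  rw [hc] at hcard
  have h11 : 11 ≤ q := by
    by_contra hlt
    clear h
    push Not at hlt
    interval_cases q <;> exact absurd hcard (by decide)
  refine ⟨h11, fun k => ?_⟩
  by_contra h2
  have h1 := h.one_le_sum_range hq k (l := 3) (n := 3) three_pos hc fun a ha => by
    have h3 := (h.two_le_of_mem_ratios hq ha).1
    have h4 : a ≠ 2 := fun h' => h2 (h' ▸ ha)
    omega
  have h3 := cscRatio_three_four_five h11
  simp only [Finset.sum_range_succ, Finset.sum_range_zero] at h1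
  norm_num at h1
  linarith

/-- Without 2, the four ratios are at least 3, and the cosecant sum reaches 1 only if both 3 and 4
occur and `q` is small. -/
theorem mem_ratios_of_card_five (h : VanishingFamily P r b) (hq : 17 ≤ q)
    (hc : Fintype.card ι = 5) (k : ι) :
    2 ∈ ratios P b k ∨ (q < 25 ∧ 3 ∈ ratios P b k ∧ 4 ∈ ratios P b k) := by
  have hq2 : 2 ≤ q := by omega
  by_contra hcon
  rw [not_or] at hcon
  obtain ⟨h2, hcon⟩ := hcon
  have hge : ∀ a ∈ ratios P b k, 3 ≤ a := fun a ha => by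
    have h3 := (h.two_le_of_mem_ratios hq2 ha).1
    have h4 : a ≠ 2 := fun h' => h2 (h' ▸ ha)
    omega
  by_cases h25 : q < 25
  · have hsum := cscRatio_three_five_six_seven hq
    by_cases h3 : 3 ∈ ratios P b k
    · have h4 : 4 ∉ ratios P b k := fun h4 => hcon ⟨h25, h3, h4⟩
      have h1 := h.one_le_sum_ratios hq2 k
      rw [← Finset.add_sum_erase _ _ h3] at h1
      have hle := sum_le_sum_range_of_antitone (f := cscRatio q) (l := 5) (M := q / 2)
        (fun a b ha hab hb => cscRatio_antitone hq2 (by omega) hab hb) 3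
        ((ratios P b k).erase 3)
        (by rw [Finset.card_erase_of_mem h3, h.card_ratios]; omega) (fun a ha => by
          obtain ⟨ha3, ha⟩ := Finset.mem_erase.mp ha
          have h5 : a ≠ 4 := fun h' => h4 (h' ▸ ha)
          have := hge a ha
          exact Finset.mem_Icc.mpr ⟨by omega, (h.two_le_of_mem_ratios hq2 ha).2⟩)
      simp only [Finset.sum_range_succ, Finset.sum_range_zero] at hle
      norm_num at hle
      linarith
    · have h1 := h.one_le_sum_range hq2 k (l := 4) (n := 4) four_pos hc fun a ha => by
        have h4 : a ≠ 3 := fun h' => h3 (h' ▸ ha)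
        have := hge a ha
        omega
      have h34 := cscRatio_antitone (q := q) (a := 3) (b := 4) hq2 (by omega) (by omega) (by omega)
      simp only [Finset.sum_range_succ, Finset.sum_range_zero] at h1
      norm_num at h1
      linarith
  · have h1 := h.one_le_sum_range hq2 k (l := 3) (n := 4) three_pos hc hge
    have h3 := cscRatio_three_four_five_six (q := q) (by omega)
    simp only [Finset.sum_range_succ, Finset.sum_range_zero] at h1
    norm_num at h1
    linarith

theorem two_mem_of_card_five (h : VanishingFamily P r b) (hq : 2 ≤ q)
    (hc : Fintype.card ι = 5) : (q = 11 ∨ q = 13) ∨ (25 ≤ q ∧ ∀ k, 2 ∈ ratios P b k) := by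
  have k : ι := (Fintype.card_pos_iff.mp (by omega)).some
  have hcard := h.card_le hq k
  rw [hc] at hcard
  rcases lt_or_ge q 17 with hlt | h17
  · left
    clear h
    interval_cases q <;> first | decide | exact absurd hcard (by decide)
  right
  rcases lt_or_ge q 25 with hlt | h25
  · exfalso
    -- For `17 ≤ q < 25` the alternative of 2, or 3 and 4 together, is refuted by enumerating the
    -- five classes up to sign.
    refine not_doubling_five_classes q (Finset.mem_Icc.mpr ⟨h17, by omega⟩)
      (Finset.univ.image fun i => absRes (P i)) ?_ ?_
    · rw [Finset.mem_powersetCard]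
      constructor
      · intro a ha
        obtain ⟨i, -, rfl⟩ := Finset.mem_image.mp ha
        have hco := coprime_absRes (h.mul_inv i)
        refine Finset.mem_filter.mpr ⟨Finset.mem_Icc.mpr ⟨?_, absRes_le _⟩, hco⟩
        rw [Nat.one_le_iff_ne_zero]
        intro h0
        rw [h0, Nat.coprime_zero_left] at hco
        omega
      · rw [Finset.card_image_of_injective, Finset.card_univ, hc]
        intro i j hij
        by_contra hne
        rcases absRes_eq_iff.mp hij with e | e
        · exact (h.ne i j hne).1 e
        · exact (h.ne i j hne).2 e
    · intro s hs
      obtain ⟨k, -, rfl⟩ := Finset.mem_image.mp hs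
      have hex : ∀ a : ℕ, a ∈ ratios P b k → ∃ t ∈ Finset.univ.image fun i => absRes (P i),
          (a * t) % q = absRes (P k) ∨ (a * t + absRes (P k)) % q = 0 := by
        intro a ha
        obtain ⟨i, hi⟩ := h.eq_mul_of_mem_ratios ha
        exact ⟨absRes (P i), Finset.mem_image_of_mem _ (Finset.mem_univ i),
          absRes_of_eq_mul hi hq⟩
      rcases h.mem_ratios_of_card_five h17 hc k with h2 | ⟨-, h3, h4⟩
      · exact Or.inl (hex 2 h2)
      · exact Or.inr ⟨hex 3 h3, hex 4 h4⟩
  · refine ⟨h25, fun k => ?_⟩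
    rcases h.mem_ratios_of_card_five h17 hc k with h2 | ⟨h2, -⟩
    · exact h2
    · omega

/-- The map that halves frequencies up to sign. -/
theorem exists_halving (h : VanishingFamily P r b) (h2 : ∀ k, 2 ∈ ratios P b k) :
    ∃ π : ι → ι, Function.Injective π ∧ ∀ k, P k = 2 * P (π k) ∨ P k = -(2 * P (π k)) := by
  have := fun k => h.eq_mul_of_mem_ratios (h2 k)
  choose π hπ using this
  push_cast at hπ
  refine ⟨π, fun k l hkl => ?_, hπ⟩
  by_contra hne
  have hk := hπ k
  rw [hkl] at hk
  rcases hk with h1 | h1 <;> rcases hπ l with h3 | h3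
  · exact (h.ne k l hne).1 (h1.trans h3.symm)
  · exact (h.ne k l hne).2 (by rw [h1, h3, neg_neg])
  · exact (h.ne k l hne).2 (by rw [h1, h3])
  · exact (h.ne k l hne).1 (h1.trans h3.symm)

/-- Distinctness of the powers of two up to sign makes the orbit of `k` under `π` exhaust the
family, and its `t`-th ratio is `± 2 ^ t`. -/
theorem sum_cscRatio_eq (h : VanishingFamily P r b) {π : ι → ι}
    (hP : ∀ k, P k = 2 * P (π k) ∨ P k = -(2 * P (π k))) {n : ℕ} (hn : Fintype.card ι = n)
    (hdist : ∀ s < n, ∀ t < n, absRes ((2 : ZMod q) ^ s) = absRes ((2 : ZMod q) ^ t) → s = t)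
    (k : ι) : ∑ i, cscRatio q (absRes (P k * b i)) =
      ∑ t ∈ Finset.range n, cscRatio q (absRes ((2 : ZMod q) ^ t)) := by
  have habs : ∀ t, absRes (P k * b (π^[t] k)) = absRes ((2 : ZMod q) ^ t) := by
    intro t
    have hb := h.mul_inv (π^[t] k)
    rw [absRes_eq_iff]
    rcases iterate_halving hP k t with h1 | h1
    · left; rw [h1]; linear_combination 2 ^ t * hb
    · right; rw [h1]; linear_combination -2 ^ t * hb
  have hinj : Set.InjOn (fun t => π^[t] k) (Finset.range n : Set ℕ) := by
    intro s hs t ht hst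
    refine hdist s (by simpa using hs) t (by simpa using ht) ?_
    simp only at hst
    rw [← habs, ← habs, hst]
  have himg : (Finset.range n).image (fun t => π^[t] k) = Finset.univ := by
    refine Finset.eq_univ_of_card _ ?_
    rw [Finset.card_image_of_injOn hinj, Finset.card_range, hn]
  rw [← himg, Finset.sum_image hinj]
  exact Finset.sum_congr rfl fun t _ => by rw [habs]

theorem not_two_pow_add_one (h : VanishingFamily P r b) {π : ι → ι}
    (hP : ∀ k, P k = 2 * P (π k) ∨ P k = -(2 * P (π k))) {n : ℕ} (hn : Fintype.card ι = n)
    (hn2 : 2 ≤ n)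
    (hdist : ∀ s < n, ∀ t < n, absRes ((2 : ZMod q) ^ s) = absRes ((2 : ZMod q) ^ t) → s = t)
    (hq : q = 2 ^ n + 1) : False := by
  have k : ι := (Fintype.card_pos_iff.mp (by omega)).some
  have h2 : 2 ≤ q := by have := Nat.one_le_two_pow (n := n); omega
  have h1 := h.sum_cscRatio_eq hP hn hdist k
  rw [← Finset.add_sum_erase _ _ (Finset.mem_univ k), h.cscRatio_self h2] at h1
  have h3 := (sum_cscRatio_two_pow hn2 (Or.inr hq)).2 hq
  have h4 := h.one_le_sum h2 k
  linarith

/-- For `q = 2 ^ n - 1` the halving map has no signs, and it determines the shifts. -/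
theorem halving_of_two_pow_sub_one (h : VanishingFamily P r b) {π : ι → ι}
    (hP : ∀ k, P k = 2 * P (π k) ∨ P k = -(2 * P (π k))) {n : ℕ} (hn : Fintype.card ι = n)
    (hn2 : 2 ≤ n)
    (hdist : ∀ s < n, ∀ t < n, absRes ((2 : ZMod q) ^ s) = absRes ((2 : ZMod q) ^ t) → s = t)
    (hq : q + 1 = 2 ^ n) (k : ι) :
    P k = 2 * P (π k) ∧ P k * (r (π k) - r k) = -2 ^ (n - 1) := by
  have h4 : 4 ≤ 2 ^ n := by
    calc 4 = 2 ^ 2 := rfl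
      _ ≤ 2 ^ n := Nat.pow_le_pow_right two_pos hn2
  have hq3 : 3 ≤ q := by omega
  have hq2 : 2 ≤ q := by omega
  have h1 := h.sum_cscRatio_eq hP hn hdist k
  rw [← Finset.add_sum_erase _ _ (Finset.mem_univ k), h.cscRatio_self hq2,
    (sum_cscRatio_two_pow hn2 (Or.inl hq)).1 hq] at h1
  have hb := h.mul_inv (π k)
  have ha : P k * b (π k) = 2 ∨ P k * b (π k) = -2 := by
    rcases hP k with e | e
    · left; rw [e]; linear_combination 2 * hb
    · right; rw [e]; linear_combination -2 * hb
  -- A fixed point would give `1 = ± 2`.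
  have hne : π k ≠ k := by
    intro e
    rw [e, h.mul_inv k] at ha
    have : absRes ((2 : ZMod q) ^ 0) = absRes ((2 : ZMod q) ^ 1) := by
      rw [absRes_eq_iff]
      rcases ha with h' | h'
      · left; rw [pow_zero, pow_one]; exact h'
      · right; rw [pow_zero, pow_one]; exact h'
    exact absurd (hdist 0 (by omega) 1 (by omega) this) (by omega)
  obtain ⟨ρ, hρ, heq⟩ := h.exists_neg_ratio hq2 k (by linarith) (π k) hne
  have hpow : 2 * 2 ^ (n - 1) = q + 1 := by
    rw [hq, ← pow_succ']; congr 1; omega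
  have e1 : P k * (r (π k) + b (π k)) =
      P k * r k + (P k * (r (π k) - r k) + P k * b (π k)) := by ring
  have e2 : P k * (r k + b k) = P k * r k + 1 := by rw [← h.mul_inv k]; ring
  rw [e1, e2, h.mul_inv k, AddChar.map_add_eq_mul, AddChar.map_add_eq_mul,
    AddChar.map_add_eq_mul] at heq
  have h0 : (ZMod.stdAddChar (P k * r k) : ℂ) ≠ 0 := by
    rw [← norm_ne_zero_iff, AddChar.norm_apply]
    exact one_ne_zero
  obtain ⟨h5, h6⟩ := phase_of_neg_ratio hq3 hpow hρ ha (D := P k * (r (π k) - r k)) (by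
    refine mul_left_cancel₀ h0 ?_
    rw [← mul_div_assoc, heq]
    ring)
  refine ⟨by linear_combination P (π k) * h5 - P k * hb, ?_⟩
  rw [h6]; push_cast; rfl

/-- The structure of vanishing families with three to five members. -/
theorem exists_binary (h : VanishingFamily P r b) (hq : 2 ≤ q) {n : ℕ}
    (hn : Fintype.card ι = n) (hn3 : 3 ≤ n) (hn5 : n ≤ 5) :
    (n = 5 ∧ (q = 11 ∨ q = 13)) ∨ (q + 1 = 2 ^ n ∧ ∃ π : ι → ι, Function.Injective π ∧
      ∀ k, P k = 2 * P (π k) ∧ P k * (r (π k) - r k) = -2 ^ (n - 1)) := by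
  have hcases : (n = 5 ∧ (q = 11 ∨ q = 13)) ∨ ((∀ k, 2 ∈ ratios P b k) ∧
      ((n = 3 ∧ q = 7) ∨ (n = 4 ∧ 11 ≤ q) ∨ (n = 5 ∧ 25 ≤ q))) := by
    interval_cases n
    · have := h.eq_seven_of_card_three hq hn
      exact Or.inr ⟨this.2, Or.inl ⟨rfl, this.1⟩⟩
    · have := h.two_mem_of_card_four hq hn
      exact Or.inr ⟨this.2, Or.inr (Or.inl ⟨rfl, this.1⟩)⟩
    · rcases h.two_mem_of_card_five hq hn with h1 | h1
      · exact Or.inl ⟨rfl, h1⟩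
      · exact Or.inr ⟨h1.2, Or.inr (Or.inr ⟨rfl, h1.1⟩)⟩
  rcases hcases with h1 | ⟨h2, hcases⟩
  · exact Or.inl h1
  right
  obtain ⟨π, hπ, hP⟩ := h.exists_halving h2
  have hdvd : q ∣ 2 ^ n - 1 ∨ q ∣ 2 ^ n + 1 := by
    rcases h.two_pow_card hπ hP with h3 | h3
    · left
      rw [← ZMod.natCast_eq_zero_iff, Nat.cast_sub Nat.one_le_two_pow]
      push_cast
      rw [← hn, h3, sub_self]
    · right
      rw [← ZMod.natCast_eq_zero_iff]
      push_cast
      rw [← hn, h3]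
      ring
  -- Only the divisors of `2 ^ n ± 1` above the lower bounds for `q` survive.
  have hfin : (n = 3 ∧ q = 7) ∨ (n = 4 ∧ q = 15) ∨ (n = 5 ∧ q = 31) ∨ (n = 4 ∧ q = 17) ∨
      (n = 5 ∧ q = 33) := by
    rcases hcases with ⟨rfl, h3⟩ | ⟨rfl, h3⟩ | ⟨rfl, h3⟩
    · exact Or.inl ⟨rfl, h3⟩
    · have hle : q ≤ 17 := by
        rcases hdvd with h4 | h4 <;> have := Nat.le_of_dvd (by norm_num) h4 <;> omega
      clear h hP hπ π h2
      interval_cases q <;> omega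
    · have hle : q ≤ 33 := by
        rcases hdvd with h4 | h4 <;> have := Nat.le_of_dvd (by norm_num) h4 <;> omega
      clear h hP hπ π h2
      interval_cases q <;> omega
  have hdist : ∀ s < n, ∀ t < n,
      absRes ((2 : ZMod q) ^ s) = absRes ((2 : ZMod q) ^ t) → s = t := by
    clear h hP hπ π h2 hdvd hcases
    rcases hfin with ⟨rfl, rfl⟩ | ⟨rfl, rfl⟩ | ⟨rfl, rfl⟩ | ⟨rfl, rfl⟩ | ⟨rfl, rfl⟩ <;>
    simp only [absRes_eq_iff] <;> decide
  have hn2 : 2 ≤ n := by omega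
  have hq' : q + 1 = 2 ^ n ∨ q = 2 ^ n + 1 := by
    rcases hfin with ⟨rfl, h3⟩ | ⟨rfl, h3⟩ | ⟨rfl, h3⟩ | ⟨rfl, h3⟩ | ⟨rfl, h3⟩ <;> omega
  rcases hq' with hq' | hq'
  · exact ⟨hq', π, hπ, h.halving_of_two_pow_sub_one hP hn hn2 hdist hq'⟩
  · exact (h.not_two_pow_add_one hP hn hn2 hdist hq').elim

end VanishingFamily

/-! ### The exceptional moduli 11 and 13 -/

/-- The integers `± 1, …, ± 5` with prescribed signs. -/
def signedFive (e : Fin 5 → Bool) (j : Fin 5) : ℤ :=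
  if e j then ((j : ℕ) + 1 : ℤ) else -((j : ℕ) + 1)

/-- The surviving patterns are `1, -2, 3, 4, 5` and its negative, with total `± 11`. -/
theorem signs_eleven : ∀ e : Fin 5 → Bool, (11 : ℤ) ∣ ∑ j, signedFive e j →
    (∀ I : Finset (Fin 5), I.Nonempty → I ≠ Finset.univ → ¬ (11 : ℤ) ∣ ∑ j ∈ I, signedFive e j) →
    e = ![true, false, true, true, true] ∨ e = ![false, true, false, false, false] := by
  decide +kernel

theorem signs_thirteen : ∀ e : Fin 5 → Bool, (13 : ℤ) ∣ ∑ j, signedFive e j →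
    (∀ I : Finset (Fin 5), I.Nonempty → I ≠ Finset.univ → ¬ (13 : ℤ) ∣ ∑ j ∈ I, signedFive e j) →
    e = ![true, false, false, false, false] ∨ e = ![false, true, true, true, true] := by
  decide +kernel

/-- The slopes are the negatives of `1, -2, 3, 4, 5` modulo 11, and the first shift is normalised to
0. The Boolean form suits evaluation by the kernel. -/
theorem not_const_eleven : ((List.range 11).all fun a => (List.range 11).all fun b =>
    (List.range 11).all fun c => (List.range 11).all fun d => (List.range 11).any fun n =>
    !Nat.beq ((10 * n) % 11 + (a + 2 * n) % 11 + (b + 8 * n) % 11 + (c + 7 * n) % 11 +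
      (d + 6 * n) % 11) (a + b + c + d)) = true := by
  decide +kernel

theorem not_const_thirteen : ((List.range 13).all fun a => (List.range 13).all fun b =>
    (List.range 13).all fun c => (List.range 13).all fun d => (List.range 13).any fun n =>
    !Nat.beq ((12 * n) % 13 + (a + 2 * n) % 13 + (b + 3 * n) % 13 + (c + 4 * n) % 13 +
      (d + 5 * n) % 13) (a + b + c + d)) = true := by
  decide +kernel

theorem exists_signed_enumeration {q : ℕ} [NeZero q] {P : Fin 5 → ZMod q}
    (hne : ∀ i k, i ≠ k → P i ≠ P k ∧ P i ≠ -P k) {u u' : ZMod q} (hu : u * u' = 1)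
    (habs : ∀ i, absRes (u * P i) ∈ Finset.Icc 1 5) :
    ∃ (σ : Fin 5 → Fin 5) (e : Fin 5 → Bool), Function.Bijective σ ∧
      ∀ j, u * P (σ j) = (signedFive e j : ZMod q) := by
  have hb : ∀ i, absRes (u * P i) - 1 < 5 := fun i => by
    have := Finset.mem_Icc.mp (habs i); omega
  let f : Fin 5 → Fin 5 := fun i => ⟨absRes (u * P i) - 1, hb i⟩
  have hf : Function.Injective f := by
    intro i j hij
    by_contra hij'
    have h1 : absRes (u * P i) - 1 = absRes (u * P j) - 1 := congrArg Fin.val hij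
    have h2 := Finset.mem_Icc.mp (habs i)
    have h3 := Finset.mem_Icc.mp (habs j)
    rcases absRes_eq_iff.mp (by omega : absRes (u * P i) = absRes (u * P j)) with h | h
    · exact (hne i j hij').1 (by linear_combination u' * h - (P i - P j) * hu)
    · exact (hne i j hij').2 (by linear_combination u' * h - (P i + P j) * hu)
  have hbij := Finite.injective_iff_bijective.mp hf
  let g := Equiv.ofBijective f hbij
  have hex : ∀ j, ∃ s : Bool, u * P (g.symm j) =
      ((if s then ((j : ℕ) + 1 : ℤ) else -((j : ℕ) + 1) : ℤ) : ZMod q) := by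
    intro j
    have h1 : absRes (u * P (g.symm j)) = j + 1 := by
      have h2 := Finset.mem_Icc.mp (habs (g.symm j))
      have h3 : absRes (u * P (g.symm j)) - 1 = j := congrArg Fin.val (g.apply_symm_apply j)
      omega
    rcases eq_or_eq_neg_absRes (u * P (g.symm j)) with h | h
    · exact ⟨true, by rw [h, h1]; simp⟩
    · exact ⟨false, by rw [h, h1]; push_cast; simp⟩
  choose e he using hex
  exact ⟨g.symm, e, g.symm.bijective, he⟩

theorem dvd_sum_signedFive_iff {q : ℕ} [NeZero q] {P : Fin 5 → ZMod q} {u u' : ZMod q}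
    (hu : u * u' = 1) {σ : Fin 5 → Fin 5} (hσ : Function.Bijective σ) {e : Fin 5 → Bool}
    (he : ∀ j, u * P (σ j) = (signedFive e j : ZMod q)) (I : Finset (Fin 5)) :
    (q : ℤ) ∣ ∑ j ∈ I, signedFive e j ↔ ∑ i ∈ I.image σ, P i = 0 := by
  rw [← ZMod.intCast_zmod_eq_zero_iff_dvd, Int.cast_sum, Finset.sum_image hσ.1.injOn,
    Finset.sum_congr rfl fun j _ => (he j).symm, ← Finset.mul_sum]
  constructor
  · intro h
    linear_combination u' * h - (∑ j ∈ I, P (σ j)) * hu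
  · intro h
    rw [h, mul_zero]

/-- Normal form of a constant sum of five sawtooth functions. -/
theorem exists_shifts_of_const {q : ℕ} [NeZero q] {P R : Fin 5 → ZMod q} {u : ZMod q}
    {σ : Fin 5 → Fin 5} (hσ : Function.Bijective σ) {c : Fin 5 → ℕ} (hcq : ∀ j, c j ≤ q)
    (he : ∀ j, u * P (σ j) = c j)
    (hF : ∀ x : ZMod q, ∑ k, sawtooth (P k) (R k) (x + 1) = ∑ k, sawtooth (P k) (R k) x) :
    ∃ s : Fin 5 → ℕ, s 0 = 0 ∧ (∀ j, s j < q) ∧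
      ∀ n : ℕ, ∑ j, (s j + (q - c j) * n) % q = ∑ j, s j := by
  have hconst : ∀ x y : ZMod q, ∑ k, sawtooth (P k) (R k) x = ∑ k, sawtooth (P k) (R k) y := by
    have h0 : ∀ x : ZMod q, ∑ k, sawtooth (P k) (R k) x = ∑ k, sawtooth (P k) (R k) 0 := by
      intro x
      rw [← ZMod.natCast_zmod_val x]
      induction x.val with
      | zero => simp
      | succ n ih => push_cast; rw [hF, ih]
    exact fun x y => (h0 x).trans (h0 y).symm
  refine ⟨fun j => sawtooth (P (σ j)) (R (σ j)) (R (σ 0)), ?_, fun j => ZMod.val_lt _, fun n => ?_⟩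
  · simp [sawtooth]
  -- Evaluating at `R (σ 0) + u n` makes the first shift zero and turns the slopes into `-u P (σ j)
  -- = -c j`.
  · have h := hconst (R (σ 0) + u * n) (R (σ 0))
    rw [← hσ.sum_comp fun k => sawtooth (P k) (R k) (R (σ 0) + u * n),
      ← hσ.sum_comp fun k => sawtooth (P k) (R k) (R (σ 0))] at h
    rw [← h]
    refine Finset.sum_congr rfl fun j _ => ?_
    simp only [sawtooth]
    rw [← ZMod.val_natCast]
    congr 1
    rw [Nat.cast_add, ZMod.natCast_zmod_val, Nat.cast_mul, Nat.cast_sub (hcq j), ZMod.natCast_self]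
    linear_combination (n : ZMod q) * he j

theorem sum_eq_zero_of_const {q : ℕ} [NeZero q] {ι : Type*} [Fintype ι] {P R : ι → ZMod q}
    (hF : ∀ x : ZMod q, ∑ k, sawtooth (P k) (R k) (x + 1) = ∑ k, sawtooth (P k) (R k) x) :
    ∑ k, P k = 0 := by
  have h := congrArg (Nat.cast : ℕ → ZMod q) (hF 0)
  simp only [sawtooth, Nat.cast_sum, ZMod.natCast_zmod_val] at h
  rw [← sub_eq_zero, ← Finset.sum_sub_distrib] at h
  have h2 : ∑ k, (-(P k * (0 + 1 - R k)) - -(P k * (0 - R k))) = -∑ k, P k := by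
    rw [← Finset.sum_neg_distrib]
    exact Finset.sum_congr rfl fun k _ => by ring
  rw [h2] at h
  exact neg_eq_zero.mp h

theorem not_const_of_eleven {P R : Fin 5 → ZMod 11}
    (hne : ∀ i k, i ≠ k → P i ≠ P k ∧ P i ≠ -P k)
    (hsum : ∀ I : Finset (Fin 5), I.Nonempty → I ≠ Finset.univ → ∑ i ∈ I, P i ≠ 0)
    (hF : ∀ x : ZMod 11, ∑ k, sawtooth (P k) (R k) (x + 1) = ∑ k, sawtooth (P k) (R k) x) :
    False := by
  have hne0 : ∀ i, P i ≠ 0 := fun i => by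
    have := hsum {i} (Finset.singleton_nonempty i) (by decide +revert)
    simpa using this
  obtain ⟨σ, e, hσ, he⟩ := exists_signed_enumeration hne (one_mul (1 : ZMod 11)) fun i => by
    rw [one_mul, Finset.mem_Icc]
    refine ⟨Nat.one_le_iff_ne_zero.mpr fun h => hne0 i ?_, absRes_le _⟩
    rcases eq_or_eq_neg_absRes (P i) with h' | h' <;> rw [h', h] <;> simp
  have hdvd := dvd_sum_signedFive_iff (one_mul (1 : ZMod 11)) hσ he
  have himg : ∀ I : Finset (Fin 5), I.image σ = Finset.univ → I = Finset.univ := fun I hI => by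
    rw [← Finset.card_eq_iff_eq_univ] at hI ⊢
    rwa [Finset.card_image_of_injective _ hσ.1] at hI
  obtain ⟨u, hu⟩ : ∃ u : ZMod 11, ∀ j, u * P (σ j) = ((![1, 9, 3, 4, 5] : Fin 5 → ℕ) j : ℕ) := by
    rcases signs_eleven e ((hdvd _).mpr (by
      rw [Finset.image_univ_of_surjective hσ.2]; exact sum_eq_zero_of_const hF))
      (fun I h1 h2 h3 => hsum (I.image σ) (h1.image σ) (fun h => h2 (himg I h)) ((hdvd I).mp h3))
      with rfl | rfl
    · exact ⟨1, fun j => by rw [he j]; revert j; decide⟩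
    · exact ⟨-1, fun j => by rw [neg_one_mul, ← one_mul (P (σ j)), he j]; revert j; decide⟩
  obtain ⟨s, h0, hs, hn⟩ := exists_shifts_of_const hσ (by decide) hu hF
  have hall := not_const_eleven
  simp only [List.all_eq_true, List.any_eq_true, List.mem_range] at hall
  obtain ⟨n, -, hbad⟩ := hall (s 1) (hs 1) (s 2) (hs 2) (s 3) (hs 3) (s 4) (hs 4)
  have h := hn n
  simp only [Fin.sum_univ_five, h0, zero_add] at h
  exact Nat.ne_of_beq_eq_false (by simpa using hbad) h

theorem not_const_of_thirteen {P R : Fin 5 → ZMod 13}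
    (hne : ∀ i k, i ≠ k → P i ≠ P k ∧ P i ≠ -P k)
    (hsum : ∀ I : Finset (Fin 5), I.Nonempty → I ≠ Finset.univ → ∑ i ∈ I, P i ≠ 0)
    (hF : ∀ x : ZMod 13, ∑ k, sawtooth (P k) (R k) (x + 1) = ∑ k, sawtooth (P k) (R k) x) :
    False := by
  have hne0 : ∀ i, P i ≠ 0 := fun i => by
    have := hsum {i} (Finset.singleton_nonempty i) (by decide +revert)
    simpa using this
  -- Five frequencies miss one of the six classes up to sign; scaling by `v` moves the missing class
  -- to `± 6`, so that `± 1, …, ± 5` remain.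
  obtain ⟨a, ha, hmiss⟩ : ∃ a ∈ Finset.Icc 1 6, ∀ i, absRes (P i) ≠ a := by
    by_contra hcon
    push Not at hcon
    have hsub : Finset.Icc 1 6 ⊆ Finset.univ.image fun i => absRes (P i) := fun a ha => by
      obtain ⟨i, hi⟩ := hcon a ha
      exact Finset.mem_image.mpr ⟨i, Finset.mem_univ i, hi⟩
    have h1 := Finset.card_le_card hsub
    have h2 := Finset.card_image_le (s := Finset.univ) (f := fun i => absRes (P i))
    rw [Nat.card_Icc] at h1
    rw [Finset.card_univ, Fintype.card_fin] at h2
    omega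
  obtain ⟨v, v', hv, hva⟩ : ∃ v v' : ZMod 13, v * v' = 1 ∧ v * (a : ZMod 13) = 6 := by
    clear hmiss
    revert a
    decide
  obtain ⟨σ, e, hσ, he⟩ := exists_signed_enumeration hne hv fun i => by
    have hle : absRes (v * P i) ≤ 6 := absRes_le _
    have h0 : absRes (v * P i) ≠ 0 := fun h => hne0 i (by
      have h0 : v * P i = 0 := by
        rcases eq_or_eq_neg_absRes (v * P i) with h' | h' <;> rw [h', h] <;> simp
      linear_combination v' * h0 - P i * hv)
    have h6 : absRes (v * P i) ≠ 6 := fun h => hmiss i (by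
      rw [← absRes_natCast (q := 13) (Finset.mem_Icc.mp ha).2, absRes_eq_iff]
      rcases eq_or_eq_neg_absRes (v * P i) with h' | h' <;> rw [h] at h' <;> push_cast at h'
      · left; linear_combination v' * h' - v' * hva - (P i - a) * hv
      · right; linear_combination v' * h' + v' * hva - (P i + a) * hv)
    rw [Finset.mem_Icc]
    omega
  have hdvd := dvd_sum_signedFive_iff hv hσ he
  have himg : ∀ I : Finset (Fin 5), I.image σ = Finset.univ → I = Finset.univ := fun I hI => by
    rw [← Finset.card_eq_iff_eq_univ] at hI ⊢
    rwa [Finset.card_image_of_injective _ hσ.1] at hI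
  obtain ⟨u, hu⟩ : ∃ u : ZMod 13, ∀ j, u * P (σ j) =
      ((![1, 11, 10, 9, 8] : Fin 5 → ℕ) j : ℕ) := by
    rcases signs_thirteen e ((hdvd _).mpr (by
      rw [Finset.image_univ_of_surjective hσ.2]; exact sum_eq_zero_of_const hF))
      (fun I h1 h2 h3 => hsum (I.image σ) (h1.image σ) (fun h => h2 (himg I h)) ((hdvd I).mp h3))
      with rfl | rfl
    · exact ⟨v, fun j => by rw [he j]; revert j; decide⟩
    · exact ⟨-v, fun j => by rw [neg_mul, he j]; revert j; decide⟩
  obtain ⟨s, h0, hs, hn⟩ := exists_shifts_of_const hσ (by decide) hu hF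
  have hall := not_const_thirteen
  simp only [List.all_eq_true, List.any_eq_true, List.mem_range] at hall
  obtain ⟨n, -, hbad⟩ := hall (s 1) (hs 1) (s 2) (hs 2) (s 3) (hs 3) (s 4) (hs 4)
  have h := hn n
  simp only [Fin.sum_univ_five, h0, zero_add] at h
  exact Nat.ne_of_beq_eq_false (by simpa using hbad) h

/-! ### Reconstruction of the binary family and the main theorem -/

theorem orderOf_two_of_add_one_eq {q m : ℕ} (hm : 2 ≤ m) (hq : q + 1 = 2 ^ m) :
    Odd q ∧ orderOf (2 : ZMod q) = m := by
  have h2m : (2 : ZMod q) ^ m = 1 := by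
    have : ((2 ^ m : ℕ) : ZMod q) = ((q + 1 : ℕ) : ZMod q) := by rw [hq]
    push_cast at this
    simpa using this
  have hm1 : 2 ^ m = 2 * 2 ^ (m - 1) := by rw [← pow_succ']; congr 1; omega
  have hm2 : 2 ≤ 2 ^ (m - 1) := by
    calc 2 = 2 ^ 1 := rfl
      _ ≤ 2 ^ (m - 1) := Nat.pow_le_pow_right two_pos (by omega)
  refine ⟨⟨2 ^ (m - 1) - 1, by omega⟩, ?_⟩
  rw [orderOf_eq_iff (by omega)]
  refine ⟨h2m, fun k hk hk0 h1 => ?_⟩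
  have hlt : 2 ^ k < q := by
    have : 2 ^ k ≤ 2 ^ (m - 1) := Nat.pow_le_pow_right two_pos (by omega)
    omega
  have h2 : ((2 ^ k : ℕ) : ZMod q) = ((1 : ℕ) : ZMod q) := by push_cast; exact h1
  rw [ZMod.natCast_eq_natCast_iff', Nat.mod_eq_of_lt hlt, Nat.mod_eq_of_lt (by omega)] at h2
  have := Nat.one_lt_two_pow (n := k) (by omega)
  omega

/-- A halving permutation with the right shifts gives a binary family. -/
theorem isBinaryFamily_of_halving {q m : ℕ} [NeZero q] (hm : 2 ≤ m) (hq : q + 1 = 2 ^ m)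
    (p r : Fin m → ℤ) (b : Fin m → ZMod q) (hb : ∀ i, (p i : ZMod q) * b i = 1)
    (π : Fin m → Fin m) (hP : ∀ k, (p k : ZMod q) = 2 * p (π k))
    (hR : ∀ k, (p k : ZMod q) * (r (π k) - r k) = -2 ^ (m - 1)) : IsBinaryFamily q p r := by
  obtain ⟨-, hord⟩ := orderOf_two_of_add_one_eq hm hq
  have h2m : (2 : ZMod q) ^ m = 1 := hord ▸ pow_orderOf_eq_one _
  let k₀ : Fin m := ⟨0, by omega⟩
  have hpj : ∀ j : ℕ, 2 ^ j * (p (π^[j] k₀) : ZMod q) = p k₀ := by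
    intro j
    induction j with
    | zero => simp
    | succ j ih =>
      rw [Function.iterate_succ_apply', ← ih, hP (π^[j] k₀)]
      ring
  have hinj : Function.Injective fun j : Fin m => π^[(j : ℕ)] k₀ := by
    intro i j hij
    simp only at hij
    have h1 := hpj i
    rw [hij, ← hpj j] at h1
    have h2 : (2 : ZMod q) ^ (i : ℕ) = 2 ^ (j : ℕ) := by
      linear_combination b (π^[(j : ℕ)] k₀) * h1 -
        (2 ^ (i : ℕ) - 2 ^ (j : ℕ)) * hb (π^[(j : ℕ)] k₀)
    exact Fin.ext (pow_injOn_Iio_orderOf (by rw [hord]; exact i.2) (by rw [hord]; exact j.2) h2)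
  -- Index 0 must satisfy `δ 2 ^ (m - 1) = p k₀`; as `2 ^ m = 1`, this means `δ = 2 p k₀`, whose
  -- inverse is `2 ^ (m - 1) b k₀`. Likewise `γ = r k₀ + δ'`.
  obtain ⟨δ', hδ'⟩ := ZMod.intCast_surjective (2 ^ (m - 1) * b k₀ : ZMod q)
  have hmm : (2 : ZMod q) * 2 ^ (m - 1) = 1 := by
    rw [← pow_succ', Nat.sub_add_cancel (by omega), h2m]
  have hδ : ((2 * p k₀ * δ' : ℤ) : ZMod q) = 1 := by
    push_cast
    rw [hδ']
    linear_combination (p k₀ : ZMod q) * b k₀ * hmm + hb k₀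
  have hδmod : 2 * p k₀ * δ' ≡ 1 [ZMOD (q : ℤ)] := by
    rw [← ZMod.intCast_eq_intCast_iff, hδ]; simp
  have hrj : ∀ j : ℕ, (r (π^[j] k₀) : ZMod q) = r k₀ + δ' - δ' * 2 ^ j := by
    intro j
    induction j with
    | zero => simp
    | succ j ih =>
      rw [Function.iterate_succ_apply']
      have h1 := hR (π^[j] k₀)
      have h2 := hpj j
      have h3 := hb (π^[j] k₀)
      have h4 := hb k₀
      rw [ih] at h1
      set x := π^[j] k₀
      have hbx : b x = 2 ^ j * b k₀ := by
        linear_combination (-b x) * h4 + b x * b k₀ * h2 * (-1) + 2 ^ j * b k₀ * h3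
      linear_combination b x * h1 - (r (π x) - (r k₀ + δ' - δ' * 2 ^ j) : ZMod q) * h3 -
        2 ^ (m - 1) * hbx + 2 ^ j * hδ'
  refine ⟨Equiv.ofBijective _ (Finite.injective_iff_bijective.mp hinj), 2 * p k₀, δ', r k₀ + δ',
    ?_, hδmod, fun k => ⟨?_, ?_⟩⟩
  · obtain ⟨c, hc⟩ := hδmod.symm.dvd
    exact ⟨δ', -c, by linear_combination hc⟩
  · rw [← ZMod.intCast_eq_intCast_iff]
    push_cast
    have h1 := hpj k
    have h2 : (2 : ZMod q) ^ m = 2 * 2 ^ (m - 1 - (k : ℕ)) * 2 ^ (k : ℕ) := by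
      rw [← pow_succ', ← pow_add]; congr 1; omega
    rw [h2m] at h2
    simp only [Equiv.ofBijective_apply]
    linear_combination (p (π^[(k : ℕ)] k₀) : ZMod q) * h2 + 2 * 2 ^ (m - 1 - (k : ℕ)) * h1
  · rw [← ZMod.intCast_eq_intCast_iff]
    push_cast
    exact hrj k

theorem isBinaryFamily_of_const {q m : ℕ} [NeZero q] (hq : 3 ≤ q) (hm : 3 ≤ m) (hm5 : m ≤ 5)
    (p r : Fin m → ℤ) (hp_inj : Function.Injective p)
    (hp_pos : ∀ k, 0 < p k) (hp_lt : ∀ k, p k < (q : ℤ))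
    (hp_gcd : gcd (q : ℤ) (Finset.univ.gcd p) = 1)
    (hp_sum : ∀ I : Finset (Fin m), I.Nonempty → I ≠ Finset.univ →
      ¬ (∑ i ∈ I, p i ≡ 0 [ZMOD (q : ℤ)]))
    (hF : ∀ x : ZMod q, ∑ k, sawtooth (p k : ZMod q) (r k) (x + 1) =
        ∑ k, sawtooth (p k : ZMod q) (r k) x) :
    q + 1 = 2 ^ m ∧ IsBinaryFamily q p r := by
  have hsum : ∀ I : Finset (Fin m), I.Nonempty → I ≠ Finset.univ →
      ∑ i ∈ I, (p i : ZMod q) ≠ 0 := by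
    intro I h1 h2 h3
    refine hp_sum I h1 h2 ?_
    rw [← ZMod.intCast_eq_intCast_iff]
    push_cast
    exact h3
  have hne : ∀ i k, i ≠ k → (p i : ZMod q) ≠ p k ∧ (p i : ZMod q) ≠ -p k := by
    intro i k hik
    constructor
    · intro h
      rw [ZMod.intCast_eq_intCast_iff, Int.ModEq, Int.emod_eq_of_lt (hp_pos i).le (hp_lt i),
        Int.emod_eq_of_lt (hp_pos k).le (hp_lt k)] at h
      exact hik (hp_inj h)
    · intro h
      refine hsum {i, k} ⟨i, by simp⟩ (fun hu => ?_) (by rw [Finset.sum_pair hik, h]; ring)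
      have := congrArg Finset.card hu
      rw [Finset.card_pair hik, Finset.card_univ, Fintype.card_fin] at this
      omega
  have hbex : ∀ i, ∃ b : ZMod q, (p i : ZMod q) * b = (Int.gcd (p i) q : ℕ) := by
    intro i
    refine ⟨(Int.gcdA (p i) q : ℤ), ?_⟩
    have := congrArg (Int.cast : ℤ → ZMod q) (Int.gcd_eq_gcd_ab (p i) q)
    push_cast at this
    rw [ZMod.natCast_self, zero_mul, add_zero] at this
    exact this.symm
  choose b hb using hbex
  have hpos : ∀ i, 0 < Int.gcd (p i) q := fun i => Int.gcd_pos_of_ne_zero_left _ (hp_pos i).ne'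
  have h3 := three_le_card_coprime (by omega) hm5 p hp_gcd
    (fun k hk => three_le_card_class p r b hp_pos hp_lt hne hb hF k hk) hpos
  set K := Finset.univ.filter fun i => Int.gcd (p i) q = 1 with hK
  have hmem : ∀ i, i ∈ K ↔ Int.gcd (p i) q = 1 := fun i => by simp [hK]
  have hvan : VanishingFamily (fun i : K => (p i : ZMod q)) (fun i => (r i : ZMod q))
      (fun i => b i) := by
    refine ⟨fun i => ?_, fun i k hik => hne i k fun h => hik (Subtype.ext h), fun k => ?_⟩
    · have := hb i
      rw [(hmem i).mp i.2] at this
      simpa using this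
    · have hk := (hmem k).mp k.2
      have := sum_fourier_class p r b hp_pos hp_lt hb hF k (fun i hi => by
        rw [hk] at hi ⊢
        exact Nat.dvd_one.mp hi)
      rw [hk] at this
      rw [← this]
      exact Finset.sum_coe_sort K fun i =>
        (ZMod.stdAddChar ((p k : ZMod q) * ((r i : ZMod q) + b i)) : ℂ) /
        (ZMod.stdAddChar ((p k : ZMod q) * b i) - 1)
  have hcardK : Fintype.card K = K.card := Fintype.card_coe K
  have hle : K.card ≤ m := by simpa using Finset.card_le_univ K
  rcases hvan.exists_binary (by omega) hcardK h3 (by omega) with ⟨h5, hq'⟩ | ⟨hq', π, hπ, hP⟩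
  · exfalso
    obtain rfl : m = 5 := by omega
    rcases hq' with rfl | rfl
    · exact not_const_of_eleven hne hsum hF
    · exact not_const_of_thirteen hne hsum hF
  -- Halving permutes `K`, so its sum equals twice itself and vanishes; the subset hypothesis then
  -- leaves no index outside `K`.
  · have hKsum : ∑ i ∈ K, (p i : ZMod q) = 0 := by
      rw [← Finset.sum_coe_sort]
      have h1 : ∑ i : K, (p i : ZMod q) = 2 * ∑ i : K, (p i : ZMod q) := by
        conv_rhs => rw [← (Finite.injective_iff_bijective.mp hπ).sum_comp]
        rw [Finset.mul_sum]
        exact Finset.sum_congr rfl fun k _ => (hP k).1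
      linear_combination -h1
    have hKu : K = Finset.univ := by
      by_contra h
      exact hsum K (Finset.card_pos.mp (by omega)) h hKsum
    have hKm : K.card = m := by rw [hKu]; simp
    rw [hKm] at hq' hP
    have hall : ∀ i, i ∈ K := fun i => by rw [hKu]; exact Finset.mem_univ i
    refine ⟨hq', isBinaryFamily_of_halving (by omega) hq' p r b
      (fun i => hvan.mul_inv ⟨i, hall i⟩) (fun i => (π ⟨i, hall i⟩ : Fin m))
      (fun i => (hP ⟨i, hall i⟩).1) (fun i => (hP ⟨i, hall i⟩).2)⟩

theorem mainTheorem4 (q m : ℕ) (hq : 3 ≤ q) (hm : 3 ≤ m) (hm5 : m ≤ 5)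
    (p r : Fin m → ℤ)
    (hp_inj : Function.Injective p)
    (hp_pos : ∀ k, 0 < p k) (hp_lt : ∀ k, p k < (q : ℤ))
    (hp_gcd : gcd (q : ℤ) (Finset.univ.gcd p) = 1)
    (hp_sum : ∀ I : Finset (Fin m), I.Nonempty → I ≠ Finset.univ →
      ¬ (∑ i ∈ I, p i ≡ 0 [ZMOD (q : ℤ)])) :
    IsPerfectCovering (fun k => beattySet (q : ℤ) (p k) (r k)) ↔
      (Odd q ∧ orderOf (2 : ZMod q) = m) ∧ IsBinaryFamily q p r := by
  have : NeZero q := ⟨by omega⟩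
  rw [isPerfectCovering_iff r (by omega) hp_pos hp_lt]
  constructor
  · intro hF
    obtain ⟨hq', hb⟩ := isBinaryFamily_of_const hq hm hm5 p r hp_inj hp_pos hp_lt hp_gcd hp_sum hF
    exact ⟨orderOf_two_of_add_one_eq (by omega) hq', hb⟩
  · rintro ⟨⟨-, hord⟩, hb⟩ x
    have h1 := sawtooth_sum_of_isBinaryFamily hq (by omega) hord hb (x + 1)
    have h2 := sawtooth_sum_of_isBinaryFamily hq (by omega) hord hb x
    omega
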